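/- **Setting.** Let $F=\frac1n\sum_{i=1}^nF_i$ with $F_i:\mathbb R^p\to\mathbb R^p$, and let $T:\mathbb R^p\rightrightarrows\mathbb R^p$ be such that: - for some $L>0$ and all $x,y$, $\langle Fx-Fy,x-y\rangle\ge\frac1{nL}\sum_{i=1}^n\|F_ix-F_iy\|^2$; - $T$ is maximally $\rho$-co-hypomonotone for some $\rho\ge0$, i.e. $\langle u-v,x-y\rangle\ge-\rho\|u-v\|^2$ for all $(x,u),(y,v)\in\operatorname{gra}T$, and $\operatorname{gra}T$ is not properly contained in the graph of another such map; - there is $x^\star$ with $0\in Fx^\star+Tx^\star$. Let $J_{\lambda T}=(\mathbb I+\lambda T)^{-1}$ and $G_\lambda x=\frac1\lambda\big(x-J_{\lambda T}(x-\lambda Fx)\big)$. **Parameters.** Let $\hat L>L$ with $\hat L\rho<1$, $\lambda>0$ with $2\rho\le\lambda<\frac{2(1+\sqrt{1-\hat L\rho})}{\hat L}$, $0<\mu<\frac23$, $\nu=\frac\mu2$, $r>3+\frac1\mu$, $\bar\beta=\frac{\lambda(4-\hat L\lambda)-4\rho}{4(1-\rho\hat L)}$, $0<\beta\le\frac{(2-\mu)\bar\beta}{2+\mu}$,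 $\Lambda=\frac{\hat L-L}{L\hat L}$, $t_k=\mu(k+r)$, $\eta_k=\frac{2\beta(t_k-1)}{t_k-\nu}$, $c_p>0$, $c_b=\frac{5\beta c_p}{\mu\Lambda}$, $\omega\in[0,1]$, $b=\lfloor c_bn^\omega\rfloor\ge1$, and $$\mathbf p_k=\begin{cases}\frac1{c_pn^\omega}+\frac{2\mu}{\mu(k+r-1)-1}&\text{if }0\le k\le K_0:=\lfloor2c_pn^\omega-r+1+\mu^{-1}\rfloor,\\ \frac2{c_pn^\omega}&\text{otherwise,}\end{cases}$$ where $n\ge1$ satisfies $n^\omega\ge\frac1{c_p}\max\big\{\frac{\mu(r-1)-1}{\mu(r-3)-1},\frac{\mu(r-1)-1}{2\mu}\big\}$. **Algorithm (VFOSA$_+$ with loopless SARAH).** Let $x^0=z^0\in\operatorname{dom}T$, $\widetilde F^0=Fx^0$, and for $k\ge0$ $$y^k=\tfrac{t_k-1}{t_k}x^k+\tfrac1{t_k}z^k,\quad x^{k+1}=y^k-\tfrac{\eta_k}\lambda\big(x^k-J_{\lambda T}(x^k-\lambda\widetilde F^k)\big),\quad z^{k+1}=z^k+\nu(x^{k+1}-y^k).$$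 For $k\ge1$, independently of the past, $\widetilde F^k=Fx^k$ with probability $\mathbf p_k$, and $\widetilde F^k=\widetilde F^{k-1}+\frac1b\sum_{i\in\mathcal S_k}(F_ix^k-F_ix^{k-1})$ with probability $1-\mathbf p_k$, where $\mathcal S_k$ consists of $b$ i.i.d. uniform indices of $\{1,\dots,n\}$, independent of the switching. Building $\widetilde F^k$ costs $n$ calls of the $F_i$ if $k=0$ or the full operator $F$ is evaluated, and $2b$ calls otherwise; each iteration needs moreover one evaluation of $J_{\lambda T}$. **Claim.** Let $$\Psi_0^2=\mu^2r^2\|G_\lambda x^0\|^2+\frac{2r-1}{4\beta^2(\mu r-1)}\|x^0-x^\star\|^2,\qquad C_\mu=\max\Big\{\sqrt2,\sqrt{\tfrac{2(1-\mu)}{2-3\mu}}\Big\}$$ (so $C_\mu=\sqrt2$ if $\mu\le\frac12$). Then for every $\epsilon>0$ there is $K\ge0$ such that $\mathbb E\|G_\lambda x^K\|^2\le\epsilon^2$ and the expected total number of calls of the $F_i$ and evaluations of $J_{\lambda T}$ needed to compute $x^K$ is at most $$\bar{\mathcal T}=\Big\lfloor n+2n\big[2+\ln(2c_pn^\omega)\big]+\frac{C_\mu\Psi_0}{\mu\epsilon}\Big(2c_bn^\omega+\frac{2n^{1-\omega}}{c_p}+1\Big)\Big\rfloor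 .$$ In particular, if $\omega=\frac12$, then $\bar{\mathcal T}=O\big(n\ln\sqrt n+\sqrt n/\epsilon\big)$: for $n\ge2$ and $\epsilon>0$ it is at most $C\,(n\ln\sqrt n+\sqrt n/\epsilon)$, where $C$ depends only on $L,\rho,\hat L,\lambda,\mu,r,\beta,c_p$ and an upper bound on $\Psi_0$. -/

import Mathlib

open MeasureTheory ProbabilityTheory

noncomputable section

namespace VFOSA

/-- The Euclidean space of dimension `d`. -/
abbrev E (d : ℕ) : Type := EuclideanSpace ℝ (Fin d)

/-! ### Operators -/

/-- A set-valued map `T` is `ρ`-co-hypomonotone: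
`⟪u - v, x - y⟫ ≥ -ρ ‖u - v‖²` for all `(x, u), (y, v)` in the graph of `T`. -/
def IsCoHypomonotone {d : ℕ} (ρ : ℝ) (T : E d → Set (E d)) : Prop :=
  ∀ x y u v : E d, u ∈ T x → v ∈ T y → -ρ * ‖u - v‖ ^ 2 ≤ inner ℝ (u - v) (x - y)

/-- `T` is maximally `ρ`-co-hypomonotone: its graph is not properly contained in the graph of
another `ρ`-co-hypomonotone map. -/
def IsMaxCoHypomonotone {d : ℕ} (ρ : ℝ) (T : E d → Set (E d)) : Prop :=
  IsCoHypomonotone ρ T ∧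
    ∀ T' : E d → Set (E d), IsCoHypomonotone ρ T' → (∀ x, T x ⊆ T' x) → T' = T

/-- The finite sum `F x = (1/n) ∑ i, F_i x`. -/
def avg {d n : ℕ} (Fi : Fin n → E d → E d) (x : E d) : E d :=
  (1 / (n : ℝ)) • ∑ i, Fi i x

/-- `F = (1/n) ∑ F_i` is `(1/L)`-average co-coercive. -/
def IsAverageCocoercive {d n : ℕ} (L : ℝ) (Fi : Fin n → E d → E d) : Prop :=
  ∀ x y : E d, 1 / ((n : ℝ) * L) * ∑ i, ‖Fi i x - Fi i y‖ ^ 2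
    ≤ inner ℝ (avg Fi x - avg Fi y) (x - y)

/-- `xs` solves the generalized equation `0 ∈ F x + T x`. -/
def IsSolution {d n : ℕ} (Fi : Fin n → E d → E d) (T : E d → Set (E d)) (xs : E d) : Prop :=
  ∃ u ∈ T xs, avg Fi xs + u = 0

/-- The resolvent `J_{λT} x = {w | x ∈ w + λ T w}` as a set. -/
def resolventSet {d : ℕ} (T : E d → Set (E d)) (lam : ℝ) (x : E d) : Set (E d) :=
  {w | ∃ u ∈ T w, x = w + lam • u}

open Classical in
/-- The resolvent `J_{λT}` as a map. (If `T` is maximally `ρ`-co-hypomonotone, `λ > 0` and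
`λ ≥ 2ρ`, the set above has exactly one element for every `x`, so that neither the choice
nor the default value matters.) -/
def resolvent {d : ℕ} (T : E d → Set (E d)) (lam : ℝ) (x : E d) : E d :=
  if h : (resolventSet T lam x).Nonempty then h.choose else x

/-- The forward-backward residual `G_λ x = (1/λ) (x - J_{λT} (x - λ F x))`. -/
def residual {d n : ℕ} (Fi : Fin n → E d → E d) (T : E d → Set (E d)) (lam : ℝ) (x : E d) : E d :=
  (1 / lam) • (x - resolvent T lam (x - lam • avg Fi x))

/-! ### Parameters -/

/-- The constants of the problem (`L`, `ρ`) and the parameters of the method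
(`Lhat`, `lam`, `mu`, `r`, `beta`, `cp`). -/
structure Params where
  L : ℝ
  ρ : ℝ
  Lhat : ℝ
  lam : ℝ
  mu : ℝ
  r : ℝ
  beta : ℝ
  cp : ℝ

namespace Params

variable (P : Params)

def nu : ℝ := P.mu / 2

/-- `β̄ = (λ (4 - L̂ λ) - 4ρ) / (4 (1 - ρ L̂))`. -/
def betaBar : ℝ :=
  (P.lam * (4 - P.Lhat * P.lam) - 4 * P.ρ) / (4 * (1 - P.ρ * P.Lhat))

/-- `Λ = (L̂ - L) / (L L̂)`. -/
def Lam : ℝ := (P.Lhat - P.L) / (P.L * P.Lhat)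

/-- `c_b = 5 β c_p / (μ Λ)`. -/
def cb : ℝ := 5 * P.beta * P.cp / (P.mu * P.Lam)

/-- The admissible range of the parameters. -/
structure Admissible : Prop where
  L_pos : 0 < P.L
  ρ_nonneg : 0 ≤ P.ρ
  L_lt_Lhat : P.L < P.Lhat
  Lhat_ρ : P.Lhat * P.ρ < 1
  lam_pos : 0 < P.lam
  lam_lower : 2 * P.ρ ≤ P.lam
  lam_upper : P.lam < 2 * (1 + √(1 - P.Lhat * P.ρ)) / P.Lhat
  mu_pos : 0 < P.mu
  mu_lt : P.mu < 2 / 3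
  r_gt : 3 + 1 / P.mu < P.r
  beta_pos : 0 < P.beta
  beta_le : P.beta ≤ (2 - P.mu) * P.betaBar / (2 + P.mu)
  cp_pos : 0 < P.cp

/-- `t_k = μ (k + r)`. -/
def t (k : ℕ) : ℝ := P.mu * (k + P.r)

/-- `η_k = 2 β (t_k - 1) / (t_k - ν)`. -/
def eta (k : ℕ) : ℝ := 2 * P.beta * (P.t k - 1) / (P.t k - P.nu)

/-- The mini-batch size `b = ⌊c_b n^ω⌋`. -/
def batch (ω : ℝ) (n : ℕ) : ℕ := ⌊P.cb * (n : ℝ) ^ ω⌋₊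

/-- `K₀ = ⌊2 c_p n^ω - r + 1 + 1/μ⌋`. -/
def K0 (ω : ℝ) (n : ℕ) : ℤ := ⌊2 * P.cp * (n : ℝ) ^ ω - P.r + 1 + 1 / P.mu⌋

/-- The switching probability `p_k`. -/
def prob (ω : ℝ) (n : ℕ) (k : ℕ) : ℝ :=
  if (k : ℤ) ≤ P.K0 ω n then
    1 / (P.cp * (n : ℝ) ^ ω) + 2 * P.mu / (P.mu * (k + P.r - 1) - 1)
  else 2 / (P.cp * (n : ℝ) ^ ω)

/-- The requirement that the number `n` of summands be large enough, and that the mini-batch be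
nonempty. -/
structure LargeEnough (ω : ℝ) (n : ℕ) : Prop where
  pos : 0 < n
  lower : (1 / P.cp) * max ((P.mu * (P.r - 1) - 1) / (P.mu * (P.r - 3) - 1))
    ((P.mu * (P.r - 1) - 1) / (2 * P.mu)) ≤ (n : ℝ) ^ ω
  batch_pos : 1 ≤ P.batch ω n

/-- `Ψ₀`, where `Ψ₀² = μ² r² ‖G_λ x⁰‖² + (2r - 1) / (4 β² (μ r - 1)) ‖x⁰ - x*‖²`. -/
def Psi0 {d n : ℕ} (Fi : Fin n → E d → E d) (T : E d → Set (E d)) (x0 xs : E d) : ℝ :=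
  √(P.mu ^ 2 * P.r ^ 2 * ‖residual Fi T P.lam x0‖ ^ 2 +
    (2 * P.r - 1) / (4 * P.beta ^ 2 * (P.mu * P.r - 1)) * ‖x0 - xs‖ ^ 2)

/-- `C_μ = max {√2, √(2 (1 - μ) / (2 - 3μ))}`; it equals `√2` if `μ ≤ 1/2`. -/
def Cmu : ℝ := max (√2) (√(2 * (1 - P.mu) / (2 - 3 * P.mu)))

/-- The complexity bound
`⌊n + 2n (2 + ln (2 c_p n^ω)) + C_μ Ψ₀ / (μ ε) (2 c_b n^ω + 2 n^(1-ω) / c_p + 1)⌋`,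
with `psi` in the place of `Ψ₀`. -/
def complexityBound (ω : ℝ) (n : ℕ) (psi ε : ℝ) : ℤ :=
  ⌊(n : ℝ) + 2 * n * (2 + Real.log (2 * P.cp * (n : ℝ) ^ ω)) +
    P.Cmu * psi / (P.mu * ε) *
      (2 * P.cb * (n : ℝ) ^ ω + 2 * (n : ℝ) ^ (1 - ω) / P.cp + 1)⌋

end Params

/-! ### The algorithm -/

/-- The random choices of one iteration: the coin (`true` means that the full operator is
evaluated) and the mini-batch of `b` indices. -/
abbrev Draw (n b : ℕ) : Type := Bool × (Fin b → Fin n)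

/-- The triple `(x^k, z^k, F̃^k)`. -/
structure State (d : ℕ) where
  x : E d
  z : E d
  Ft : E d

/-- The loopless-SARAH estimator at the new point `xnew`, from the estimator `Fold` at the old point
`xold`. -/
def sarah {d n b : ℕ} (Fi : Fin n → E d → E d) (u : Draw n b) (Fold xold xnew : E d) : E d :=
  if u.1 then avg Fi xnew
  else Fold + ((1 / (b : ℝ)) • ∑ j, Fi (u.2 j) xnew - (1 / (b : ℝ)) • ∑ j, Fi (u.2 j) xold)

/-- The iterates along a sequence of draws `u`; `u k` is used to build `F̃^k` for `k ≥ 1`, and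
`F̃^0 = F x^0`. -/
def iter {d n b : ℕ} (P : Params) (Fi : Fin n → E d → E d) (T : E d → Set (E d)) (x0 : E d)
    (u : ℕ → Draw n b) : ℕ → State d
  | 0 => ⟨x0, x0, avg Fi x0⟩
  | k + 1 =>
    let s := iter P Fi T x0 u k
    let Gt := (1 / P.lam) • (s.x - resolvent T P.lam (s.x - P.lam • s.Ft))
    let y := ((P.t k - 1) / P.t k) • s.x + (1 / P.t k) • s.z
    let x' := y - P.eta k • Gt
    let z' := s.z + P.nu • (x' - y)
    ⟨x', z', sarah Fi (u (k + 1)) s.Ft s.x x'⟩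

/-- The number of evaluations of the components `F_i` needed to build `F̃^k`: `n` for a full
evaluation, `2b` for a mini-batch at two points. -/
def estimatorCost {n b : ℕ} (u : ℕ → Draw n b) (k : ℕ) : ℕ :=
  if k = 0 ∨ (u k).1 = true then n else 2 * b

/-- The number of evaluations of the components `F_i` and of `J_{λT}` needed to compute `x^K`:
each of the iterations `k = 0, …, K - 1` builds `F̃^k` and evaluates `J_{λT}` once. -/
def oracleCalls {n b : ℕ} (u : ℕ → Draw n b) (K : ℕ) : ℕ :=
  ∑ k ∈ Finset.range K, (estimatorCost u k + 1)

/-- The draws are independent, and in the draw `k` the coin shows `true` with probability `p k`,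
while the `b` indices are i.i.d. uniform on `Fin n` and independent of the coin. -/
structure IsSarahSampling {Ω : Type*} [MeasurableSpace Ω] (μ : Measure Ω) {n b : ℕ}
    (p : ℕ → ℝ) (U : ℕ → Ω → Draw n b) : Prop where
  measurable : ∀ k, Measurable (U k)
  law : ∀ (k : ℕ) (c : Bool) (s : Fin b → Fin n),
    μ.real {w | U k w = (c, s)} = (if c = true then p k else 1 - p k) * (1 / (n : ℝ)) ^ b
  indep : iIndepFun U μ

end VFOSA

end

/-!
The argument is a Lyapunov analysis with an inexact residual. Write `G` for the residual `G_λ`, `G̃`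
for the residual formed from the estimate `F̃`, and `t = t_k`.

*Resolvent.* After the change of coordinates `(w, u) ↦ (w + ρ u, u)` the graph of `T` is monotone, so
Minty's theorem makes `J_{λT}` everywhere defined (`IsMaxCoHypomonotone.resolventSet_nonempty`). It
is proved here in finite dimension: finitely many of the required inequalities are solved by
maximising a concave quadratic over a simplex, and compactness gives all of them.
Since `λ ≥ 2ρ` the resolvent is nonexpansive, whence `‖G̃ - G‖ ≤ ‖F̃ - F x‖`. Minimising over
the forward part shows that `G` is `β̄`-co-coercive with the surplus `Λ · (1/n) ∑ ‖F_i x - F_i y‖²`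
(`residual_cocoercive`).

*Descent.* The Lyapunov function `β s (s - 1) ‖G‖² + s ⟪G, x - z⟫ + κ ‖z - x⋆‖²`, with `s = t_k - μ`
and a slowly decreasing weight `κ`, satisfies a one-step inequality (`lyapunov_step`) in which the
error costs at most `(5β / 2μ) t (t - 1) ‖F̃ - F x‖²`, while the surplus yields
`t (t - 1) Λ · (1/n) ∑ ‖F_i x' - F_i x‖²`. The three inner products with the error are absorbed by
the slack `β < β̄`, by the decrease of `κ`, and by the loss in the coefficient of `‖G‖²`, which
exists because `μ < 2/3`.

*Variance.* The mean square error of the estimator obeys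
`E‖e'‖² ≤ (1 - p) (‖e‖² + (1/b) (1/n) ∑ ‖F_i x' - F_i x‖²)` (`sum_sarah_error_le`). Adding the error
with the weight `b Λ t (t - 1)` gives a potential that decreases in expectation: the part
`2μ / (t - 1)` of `p` offsets the growth of the weight (`weight_contraction`), and the part
`1 / (c_p n^ω)` pays for the error because `b / (c_p n^ω) ≥ c_b / (2 c_p)`
(`Params.Admissible.batch_ge`). As the potential dominates a multiple of `s² ‖G‖²`
(`le_lyapunov`), this yields `μ² K² E‖G x^K‖² ≤ C_μ² Ψ₀²`, and `K = ⌈C_μ Ψ₀ / (μ ε)⌉` iterations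
suffice.

*Cost.* The initial iteration costs `n + 1`, every later one at most `n p_k + 2b + 1` in expectation,
and the harmonic part of `∑ p_k` sums to a logarithm (`Params.Admissible.sum_prob_le`).
-/

noncomputable section

namespace VFOSA

/-! ### Minty's theorem and the resolvent -/

section Minty

variable {E : Type*} [NormedAddCommGroup E] [InnerProductSpace ℝ E]

/-- The weighted form of Young's inequality that every absorption step below uses. -/
lemma young_inner {c d p : ℝ} (hc : 0 < c) (h : p ^ 2 ≤ c * d) (a b : E) :
    0 ≤ c * ‖a‖ ^ 2 + 2 * p * inner ℝ a b + d * ‖b‖ ^ 2 := by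
  have h1 : ‖c • a + p • b‖ ^ 2 = c ^ 2 * ‖a‖ ^ 2 + 2 * (c * p) * inner ℝ a b + p ^ 2 * ‖b‖ ^ 2 := by
    rw [norm_add_sq_real, norm_smul, norm_smul, real_inner_smul_left, real_inner_smul_right,
      mul_pow, mul_pow, Real.norm_eq_abs, Real.norm_eq_abs, sq_abs, sq_abs]
    ring
  have h2 : 0 ≤ ‖c • a + p • b‖ ^ 2 := sq_nonneg _
  have h3 : 0 ≤ (c * d - p ^ 2) * ‖b‖ ^ 2 := mul_nonneg (by linarith) (sq_nonneg _)
  refine nonneg_of_mul_nonneg_right (a := c) ?_ hc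
  nlinarith

/-- The finite case of the Debrunner–Flor lemma. The weights are chosen to maximise the concave
quadratic `-‖∑ αᵢ (xᵢ - uᵢ)‖² / 4 - ∑ αᵢ ⟪uᵢ, xᵢ⟫` over the simplex: the first-order condition in
the direction of the `j`-th vertex is the inequality for `j`, up to the value of the quadratic,
which is nonpositive by monotonicity. -/
lemma exists_forall_inner_nonneg_of_fintype {ι : Type*} [Fintype ι] (x u : ι → E)
    (h : ∀ i j, 0 ≤ inner ℝ (u i - u j) (x i - x j)) :
    ∃ w : E, ∀ i, 0 ≤ inner ℝ (u i + w) (x i - w) := by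
  classical
  rcases isEmpty_or_nonempty ι with hι | hι
  · exact ⟨0, fun i => (hι.false i).elim⟩
  let c : (ι → ℝ) → E := fun a => ∑ i, a i • (x i - u i)
  let m : (ι → ℝ) → ℝ := fun a => ∑ i, a i * inner ℝ (u i) (x i)
  have hcont : Continuous fun a => -(1 / 4) * ‖c a‖ ^ 2 - m a := by
    simp only [c, m]
    fun_prop
  obtain ⟨a, ha, hmax⟩ := (isCompact_stdSimplex ℝ ι).exists_isMaxOn
    ⟨_, single_mem_stdSimplex ℝ hι.some⟩ hcont.continuousOn
  -- The maximal value is nonpositive.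
  have hval : -(1 / 4) * ‖c a‖ ^ 2 - m a ≤ 0 := by
    set X := ∑ i, a i • x i with hX
    set V := ∑ i, a i • u i with hV
    have h1 : c a = X - V := by
      simp only [c, hX, hV, smul_sub, Finset.sum_sub_distrib]
    have h2 : inner ℝ V X = ∑ i, ∑ j, a i * a j * inner ℝ (u i) (x j) := by
      simp only [hX, hV, sum_inner, inner_sum, real_inner_smul_left, real_inner_smul_right]
      rw [Finset.sum_comm]
      refine Finset.sum_congr rfl fun i _ => Finset.sum_congr rfl fun j _ => by ring
    have h3 : 0 ≤ ∑ i, ∑ j, a i * a j * inner ℝ (u i - u j) (x i - x j) :=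
      Finset.sum_nonneg fun i _ => Finset.sum_nonneg fun j _ =>
        mul_nonneg (mul_nonneg (ha.1 i) (ha.1 j)) (h i j)
    have h4 : ∑ i, ∑ j, a i * a j * inner ℝ (u i - u j) (x i - x j) = 2 * m a - 2 * inner ℝ V X := by
      have e1 : ∀ i j, a i * a j * inner ℝ (u i - u j) (x i - x j) =
          a i * inner ℝ (u i) (x i) * a j + a i * (a j * inner ℝ (u j) (x j))
            - a i * a j * inner ℝ (u i) (x j) - a j * a i * inner ℝ (u j) (x i) := by
        intro i j
        simp only [inner_sub_left, inner_sub_right]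
        ring
      simp only [e1, Finset.sum_sub_distrib, Finset.sum_add_distrib, ← Finset.mul_sum,
        ← Finset.sum_mul, ha.2]
      rw [Finset.sum_comm (f := fun i j => a j * a i * inner ℝ (u j) (x i)), ← h2]
      simp only [m]
      ring
    have h5 : 0 ≤ ‖X + V‖ ^ 2 := sq_nonneg _
    rw [norm_add_sq_real, real_inner_comm] at h5
    rw [h1, norm_sub_sq_real, real_inner_comm]
    linarith
  refine ⟨(1 / 2 : ℝ) • c a, fun j => ?_⟩
  -- Optimality along the segment from `a` to the `j`-th vertex.
  have hseg : ∀ s : ℝ, 0 < s → s ≤ 1 →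
      -(1 / 2) * inner ℝ (c a) (x j - u j - c a) - (inner ℝ (u j) (x j) - m a)
        ≤ s * (‖x j - u j - c a‖ ^ 2 / 4) := by
    intro s hs hs1
    set a' : ι → ℝ := (1 - s) • a + s • Pi.single j 1 with ha'
    have hmem : a' ∈ stdSimplex ℝ ι :=
      (convex_stdSimplex ℝ ι) ha (single_mem_stdSimplex ℝ j) (by linarith) hs.le (by ring)
    have hc' : c a' = c a + s • (x j - u j - c a) := by
      simp only [c, ha', Pi.add_apply, Pi.smul_apply, smul_eq_mul, add_smul, mul_smul,
        Finset.sum_add_distrib, ← Finset.smul_sum]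
      have : ∑ i, (Pi.single j (1 : ℝ) : ι → ℝ) i • (x i - u i) = x j - u j := by
        simp [Pi.single_apply, ite_smul]
      rw [this]
      module
    have hm' : m a' = m a + s * (inner ℝ (u j) (x j) - m a) := by
      simp only [m, ha', Pi.add_apply, Pi.smul_apply, smul_eq_mul, add_mul, mul_assoc,
        Finset.sum_add_distrib, ← Finset.mul_sum]
      have : ∑ i, (Pi.single j (1 : ℝ) : ι → ℝ) i * inner ℝ (u i) (x i) = inner ℝ (u j) (x j) := by
        simp [Pi.single_apply]
      rw [this]
      ring
    have hle : -(1 / 4) * ‖c a'‖ ^ 2 - m a' ≤ -(1 / 4) * ‖c a‖ ^ 2 - m a := hmax hmem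
    rw [hc', hm', norm_add_sq_real, real_inner_smul_right, norm_smul, mul_pow, Real.norm_eq_abs,
      sq_abs] at hle
    refine le_of_mul_le_mul_left ?_ hs
    nlinarith
  have hder : -(1 / 2) * inner ℝ (c a) (x j - u j - c a) - (inner ℝ (u j) (x j) - m a) ≤ 0 := by
    by_contra! hpos
    set A := -(1 / 2) * inner ℝ (c a) (x j - u j - c a) - (inner ℝ (u j) (x j) - m a)
    set B := ‖x j - u j - c a‖ ^ 2 / 4
    have hB : 0 ≤ B := by positivity
    have h1 := hseg (min 1 (A / (2 * (B + 1)))) (lt_min one_pos (by positivity)) (min_le_left _ _)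
    have h2 : min 1 (A / (2 * (B + 1))) * B ≤ A / (2 * (B + 1)) * B :=
      mul_le_mul_of_nonneg_right (min_le_right _ _) hB
    have h3 : A / (2 * (B + 1)) * B ≤ A / 2 := by
      rw [div_mul_eq_mul_div, div_le_div_iff₀ (by positivity) (by positivity)]
      nlinarith
    linarith
  simp only [inner_sub_right, inner_add_left, real_inner_smul_left,
    real_inner_smul_right, real_inner_self_eq_norm_sq] at hder ⊢
  rw [real_inner_comm (c a) (u j), norm_smul, mul_pow]
  norm_num at hder hval ⊢
  linarith

/-- The Debrunner–Flor lemma for an arbitrary monotone set: the constraint belonging to `(x, u)`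
confines `w` to the closed ball with diameter `[-u, x]`, so that compactness reduces the claim to
finitely many constraints. -/
lemma exists_forall_inner_nonneg [FiniteDimensional ℝ E] (M : Set (E × E))
    (hM : ∀ p ∈ M, ∀ q ∈ M, 0 ≤ inner ℝ (p.2 - q.2) (p.1 - q.1)) :
    ∃ w : E, ∀ p ∈ M, 0 ≤ inner ℝ (p.2 + w) (p.1 - w) := by
  classical
  rcases M.eq_empty_or_nonempty with rfl | ⟨p₀, hp₀⟩
  · exact ⟨0, by simp⟩
  have : ProperSpace E := FiniteDimensional.proper_rclike ℝ E
  have hball : ∀ p : E × E, ∀ w : E, 0 ≤ inner ℝ (p.2 + w) (p.1 - w) →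
      w ∈ Metric.closedBall ((1 / 2 : ℝ) • (p.1 - p.2)) (‖p.1 + p.2‖ / 2) := by
    intro p w h
    rw [mem_closedBall_iff_norm]
    refine abs_le_of_sq_le_sq' ?_ (by positivity) |>.2
    rw [div_pow, norm_sub_sq_real, norm_add_sq_real, norm_smul, mul_pow, norm_sub_sq_real,
      real_inner_smul_right]
    simp only [inner_sub_right, inner_add_left, real_inner_self_eq_norm_sq] at h ⊢
    norm_num
    rw [real_inner_comm p.1 p.2, real_inner_comm w p.2] at h
    linarith
  let t : M → Set E := fun p => {w | 0 ≤ inner ℝ (p.1.2 + w) (p.1.1 - w)}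
  have ht : ∀ p, IsClosed (t p) := fun p => isClosed_le continuous_const (by fun_prop)
  obtain ⟨w, -, hw⟩ := (isCompact_closedBall ((1 / 2 : ℝ) • (p₀.1 - p₀.2))
    (‖p₀.1 + p₀.2‖ / 2)).inter_iInter_nonempty t ht (by
      intro s
      obtain ⟨w, hw⟩ := exists_forall_inner_nonneg_of_fintype
        (fun i : (insert ⟨p₀, hp₀⟩ s : Finset M) => i.1.1.1) (fun i => i.1.1.2)
        (fun i j => hM _ i.1.2 _ j.1.2)
      refine ⟨w, hball p₀ w (hw ⟨⟨p₀, hp₀⟩, Finset.mem_insert_self _ _⟩), ?_⟩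
      simp only [Set.mem_iInter]
      exact fun p hp => hw ⟨p, Finset.mem_insert_of_mem hp⟩)
  exact ⟨w, fun p hp => Set.mem_iInter.1 hw ⟨p, hp⟩⟩

end Minty

/-- A pair that is compatible with the whole graph of a maximal map belongs to the graph. -/
lemma IsMaxCoHypomonotone.mem_of_forall {d : ℕ} {ρ : ℝ} {T : E d → Set (E d)}
    (hT : IsMaxCoHypomonotone ρ T) {w u : E d}
    (h : ∀ y v, v ∈ T y → -ρ * ‖v - u‖ ^ 2 ≤ inner ℝ (v - u) (y - w)) : u ∈ T w := by
  have h' : ∀ y v, v ∈ T y → -ρ * ‖u - v‖ ^ 2 ≤ inner ℝ (u - v) (w - y) := fun y v hv => by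
    rw [norm_sub_rev, ← neg_sub v u, ← neg_sub y w, inner_neg_neg]
    exact h y v hv
  have hT' := hT.2 (fun x => T x ∪ {v | x = w ∧ v = u}) (by
    rintro x y a b (ha | ⟨rfl, rfl⟩) (hb | ⟨rfl, rfl⟩)
    · exact hT.1 x y a b ha hb
    · exact h _ _ ha
    · exact h' _ _ hb
    · simp) (fun x => Set.subset_union_left)
  rw [← hT']
  exact Or.inr ⟨rfl, rfl⟩

/-- Minty's theorem for co-hypomonotone maps. In the coordinates `(w + ρ u, u)` the graph of `T` is
monotone, and `J_{λT}` becomes the resolvent with parameter `λ - ρ > 0`. -/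
lemma IsMaxCoHypomonotone.resolventSet_nonempty {d : ℕ} {ρ lam : ℝ} {T : E d → Set (E d)}
    (hT : IsMaxCoHypomonotone ρ T) (hlam : ρ < lam) (x : E d) :
    (resolventSet T lam x).Nonempty := by
  have hs : 0 < lam - ρ := by linarith
  obtain ⟨W, hW⟩ := exists_forall_inner_nonneg
    {p : E d × E d | ∃ w u, u ∈ T w ∧ p = (w + ρ • u - x, (lam - ρ) • u)} (by
      rintro _ ⟨w, u, hu, rfl⟩ _ ⟨w', u', hu', rfl⟩
      have h1 := hT.1 w w' u u' hu hu'
      have h2 : w + ρ • u - x - (w' + ρ • u' - x) = (w - w') + ρ • (u - u') := by module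
      rw [h2, ← smul_sub, real_inner_smul_left, inner_add_right, real_inner_smul_right,
        real_inner_self_eq_norm_sq]
      exact mul_nonneg hs.le (by linarith))
  set u₀ : E d := -(lam - ρ)⁻¹ • W with hu₀
  have hWu : W = -((lam - ρ) • u₀) := by
    rw [hu₀, smul_smul, mul_neg, mul_inv_cancel₀ hs.ne', neg_one_smul, neg_neg]
  refine ⟨x + W - ρ • u₀, u₀, hT.mem_of_forall fun y v hv => ?_, ?_⟩
  · have h1 := hW _ ⟨y, v, hv, rfl⟩
    have h2 : (lam - ρ) • v + W = (lam - ρ) • (v - u₀) := by rw [hWu]; module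
    have h3 : y + ρ • v - x - W = (y - (x + W - ρ • u₀)) + ρ • (v - u₀) := by module
    rw [h2, h3, real_inner_smul_left, inner_add_right, real_inner_smul_right,
      real_inner_self_eq_norm_sq] at h1
    have := nonneg_of_mul_nonneg_right h1 hs
    linarith
  · rw [hWu]; module

lemma resolvent_spec {d : ℕ} {ρ lam : ℝ} {T : E d → Set (E d)}
    (hT : IsMaxCoHypomonotone ρ T) (hlam : ρ < lam) (x : E d) :
    ∃ u ∈ T (resolvent T lam x), x = resolvent T lam x + lam • u := by
  have h := hT.resolventSet_nonempty hlam x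
  rw [resolvent, dif_pos h]
  exact h.choose_spec

/-- The (inexact) residual `(x - J_{λT} (x - λ f)) / λ` lies in `f + T` of the resolvent point. -/
lemma sub_mem_of_residual {d : ℕ} {ρ lam : ℝ} {T : E d → Set (E d)}
    (hT : IsMaxCoHypomonotone ρ T) (hlam : ρ < lam) (hlam0 : 0 < lam) (x f : E d) :
    (1 / lam) • (x - resolvent T lam (x - lam • f)) - f ∈
      T (x - lam • ((1 / lam) • (x - resolvent T lam (x - lam • f)))) := by
  obtain ⟨u, hu, hx⟩ := resolvent_spec hT hlam (x - lam • f)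
  set J := resolvent T lam (x - lam • f)
  have h1 : lam • ((1 / lam) • (x - J)) = x - J := by
    rw [smul_smul, mul_one_div_cancel hlam0.ne', one_smul]
  have h2 : x - J = lam • (u + f) := by
    rw [sub_eq_iff_eq_add] at hx
    rw [hx]; module
  have h3 : (1 / lam) • (x - J) - f = u := by
    rw [h2, smul_smul, one_div_mul_cancel hlam0.ne', one_smul, add_sub_cancel_right]
  rw [h1, h3, sub_sub_cancel]
  exact hu

/-! ### Co-coercivity of the residual -/

section Cocoercive

variable {E : Type*} [NormedAddCommGroup E] [InnerProductSpace ℝ E]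

/-- Co-hypomonotonicity at the two resolvent points and `1/L̂`-co-coercivity of the forward part
combine to `β̄`-co-coercivity of the residual: `β̄` is what remains after minimising over the
difference of the forward parts. The surplus `Q` is carried along. -/
lemma residual_inner_ge {Lhat ρ lam Q : ℝ} (hL : 0 < Lhat) (hLρ : Lhat * ρ < 1)
    {x y G H f g : E}
    (h1 : -ρ * ‖(G - f) - (H - g)‖ ^ 2 ≤
      inner ℝ ((G - f) - (H - g)) ((x - lam • G) - (y - lam • H)))
    (h2 : 1 / Lhat * ‖f - g‖ ^ 2 + Q ≤ inner ℝ (f - g) (x - y)) :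
    (lam * (4 - Lhat * lam) - 4 * ρ) / (4 * (1 - ρ * Lhat)) * ‖G - H‖ ^ 2 + Q ≤
      inner ℝ (G - H) (x - y) := by
  have e1 : (G - f) - (H - g) = (G - H) - (f - g) := by abel
  have e2 : (x - lam • G) - (y - lam • H) = (x - y) - lam • (G - H) := by module
  rw [e1, e2] at h1
  set a := G - H
  set b := f - g
  set δ := x - y
  clear_value a b δ
  have hc : 0 < 1 / Lhat - ρ := by
    rw [sub_pos, lt_div_iff₀ hL]; linarith
  have hy := young_inner (p := -(lam - 2 * ρ) / 2) (d := (-(lam - 2 * ρ) / 2) ^ 2 / (1 / Lhat - ρ))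
    hc (by rw [mul_div_cancel₀ _ hc.ne']) b a
  rw [norm_sub_sq_real, inner_sub_left, inner_sub_right, inner_sub_right, real_inner_smul_right,
    real_inner_smul_right, real_inner_self_eq_norm_sq, real_inner_comm] at h1
  have hβ : (lam * (4 - Lhat * lam) - 4 * ρ) / (4 * (1 - ρ * Lhat)) =
      lam - ρ - (-(lam - 2 * ρ) / 2) ^ 2 / (1 / Lhat - ρ) := by
    have h3 : 1 - ρ * Lhat ≠ 0 := by nlinarith
    have h5 : 1 - Lhat * ρ ≠ 0 := by nlinarith
    have h4 : 1 / Lhat - ρ = (1 - ρ * Lhat) / Lhat := by field_simp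
    rw [h4]
    field_simp
    ring
  rw [hβ]
  nlinarith

/-- Two points of a resolvent with parameter `λ ≥ 2ρ` are at most as far apart as their
preimages; here the preimages `x - λ f` and `x - λ g` differ by the forward parts only, and the
claim is stated for the residuals. -/
lemma norm_residual_sub_le {ρ lam : ℝ} (hlam : 2 * ρ ≤ lam) (hlam0 : 0 < lam) {x G H f g : E}
    (h1 : -ρ * ‖(G - f) - (H - g)‖ ^ 2 ≤
      inner ℝ ((G - f) - (H - g)) ((x - lam • G) - (x - lam • H))) :
    ‖G - H‖ ^ 2 ≤ ‖f - g‖ ^ 2 := by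
  have e1 : (G - f) - (H - g) = (G - H) - (f - g) := by abel
  have e2 : (x - lam • G) - (x - lam • H) = -(lam • (G - H)) := by module
  rw [e1, e2] at h1
  set a := G - H
  set b := f - g
  clear_value a b
  rw [inner_neg_right, inner_sub_left, real_inner_smul_right, real_inner_smul_right,
    real_inner_self_eq_norm_sq] at h1
  have h3 := norm_sub_sq_real a b
  rw [real_inner_comm] at h3
  have h2 : 0 ≤ ‖a - b‖ ^ 2 := sq_nonneg _
  have h4 : 0 ≤ lam * (‖b‖ ^ 2 - ‖a‖ ^ 2) := by nlinarith
  have := nonneg_of_mul_nonneg_right h4 hlam0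
  linarith

end Cocoercive

/-- The mean of the squared distances `‖F_i x - F_i y‖²`. -/
def meanSqDiff {d n : ℕ} (Fi : Fin n → E d → E d) (x y : E d) : ℝ :=
  1 / (n : ℝ) * ∑ i, ‖Fi i x - Fi i y‖ ^ 2

lemma meanSqDiff_nonneg {d n : ℕ} (Fi : Fin n → E d → E d) (x y : E d) :
    0 ≤ meanSqDiff Fi x y := by
  unfold meanSqDiff; positivity

lemma norm_avg_sub_sq_le {d n : ℕ} (Fi : Fin n → E d → E d) (x y : E d) :
    ‖avg Fi x - avg Fi y‖ ^ 2 ≤ meanSqDiff Fi x y := by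
  have h1 : avg Fi x - avg Fi y = (1 / (n : ℝ)) • ∑ i, (Fi i x - Fi i y) := by
    rw [avg, avg, ← smul_sub, Finset.sum_sub_distrib]
  have h2 : ‖∑ i, (Fi i x - Fi i y)‖ ^ 2 ≤ n * ∑ i, ‖Fi i x - Fi i y‖ ^ 2 := by
    calc ‖∑ i, (Fi i x - Fi i y)‖ ^ 2 ≤ (∑ i, ‖Fi i x - Fi i y‖) ^ 2 := by
          gcongr; exact norm_sum_le _ _
      _ ≤ n * ∑ i, ‖Fi i x - Fi i y‖ ^ 2 := by
          simpa using sq_sum_le_card_mul_sum_sq (s := Finset.univ) (f := fun i => ‖Fi i x - Fi i y‖)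
  rw [h1, norm_smul, mul_pow, Real.norm_eq_abs, sq_abs, meanSqDiff]
  rcases Nat.eq_zero_or_pos n with rfl | hn
  · simp
  · have hn' : (0 : ℝ) < n := by exact_mod_cast hn
    calc (1 / (n : ℝ)) ^ 2 * ‖∑ i, (Fi i x - Fi i y)‖ ^ 2
        ≤ (1 / (n : ℝ)) ^ 2 * (n * ∑ i, ‖Fi i x - Fi i y‖ ^ 2) := by gcongr
      _ = _ := by field_simp

/-- Average co-coercivity splits into `1/L̂`-co-coercivity of `F` and a multiple `Λ` of the mean
square variation of the components, which pays for the variance of the estimator. -/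
lemma IsAverageCocoercive.inner_ge {d n : ℕ} {P : Params} (hP : P.Admissible)
    {Fi : Fin n → E d → E d} (hF : IsAverageCocoercive P.L Fi) (x y : E d) :
    1 / P.Lhat * ‖avg Fi x - avg Fi y‖ ^ 2 + P.Lam * meanSqDiff Fi x y ≤
      inner ℝ (avg Fi x - avg Fi y) (x - y) := by
  have hL := hP.L_pos
  have hLh : 0 < P.Lhat := hL.trans hP.L_lt_Lhat
  have h1 : 1 / ((n : ℝ) * P.L) * ∑ i, ‖Fi i x - Fi i y‖ ^ 2 = 1 / P.L * meanSqDiff Fi x y := by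
    rw [meanSqDiff, ← mul_assoc]; congr 1; field_simp
  have h2 : P.Lam = 1 / P.L - 1 / P.Lhat := by
    rw [Params.Lam]; field_simp
  have h3 : 1 / P.Lhat * ‖avg Fi x - avg Fi y‖ ^ 2 ≤ 1 / P.Lhat * meanSqDiff Fi x y :=
    mul_le_mul_of_nonneg_left (norm_avg_sub_sq_le Fi x y) (by positivity)
  have h4 := hF x y
  rw [h1] at h4
  rw [h2]
  linarith

lemma Params.Admissible.ρ_lt_lam {P : Params} (hP : P.Admissible) : P.ρ < P.lam := by
  have := hP.ρ_nonneg
  have := hP.lam_lower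
  have := hP.lam_pos
  linarith

lemma residual_mem {d n : ℕ} {P : Params} (hP : P.Admissible) {T : E d → Set (E d)}
    (hT : IsMaxCoHypomonotone P.ρ T) (Fi : Fin n → E d → E d) (x : E d) :
    residual Fi T P.lam x - avg Fi x ∈ T (x - P.lam • residual Fi T P.lam x) :=
  sub_mem_of_residual hT hP.ρ_lt_lam hP.lam_pos x (avg Fi x)

/-- The residual is `β̄`-co-coercive, with a surplus that later pays for the variance. -/
lemma residual_cocoercive {d n : ℕ} {P : Params} (hP : P.Admissible) {Fi : Fin n → E d → E d}
    {T : E d → Set (E d)} (hF : IsAverageCocoercive P.L Fi) (hT : IsMaxCoHypomonotone P.ρ T)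
    (x y : E d) :
    P.betaBar * ‖residual Fi T P.lam x - residual Fi T P.lam y‖ ^ 2 + P.Lam * meanSqDiff Fi x y ≤
      inner ℝ (residual Fi T P.lam x - residual Fi T P.lam y) (x - y) :=
  residual_inner_ge (hP.L_pos.trans hP.L_lt_Lhat) hP.Lhat_ρ
    (hT.1 _ _ _ _ (residual_mem hP hT Fi x) (residual_mem hP hT Fi y)) (hF.inner_ge hP x y)

lemma Params.Admissible.Lam_pos {P : Params} (hP : P.Admissible) : 0 < P.Lam :=
  div_pos (sub_pos.2 hP.L_lt_Lhat) (mul_pos hP.L_pos (hP.L_pos.trans hP.L_lt_Lhat))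

/-- Co-coercivity between a point and a solution, where the residual vanishes. -/
lemma residual_cocoercive_solution {d n : ℕ} {P : Params} (hP : P.Admissible)
    {Fi : Fin n → E d → E d} {T : E d → Set (E d)} (hF : IsAverageCocoercive P.L Fi)
    (hT : IsMaxCoHypomonotone P.ρ T) {xs : E d} (hxs : IsSolution Fi T xs) (x : E d) :
    P.betaBar * ‖residual Fi T P.lam x‖ ^ 2 ≤ inner ℝ (residual Fi T P.lam x) (x - xs) := by
  obtain ⟨u, hu, h0⟩ := hxs
  have hu' : (0 : E d) - avg Fi xs ∈ T (xs - P.lam • (0 : E d)) := by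
    rw [smul_zero, sub_zero, zero_sub, ← eq_neg_of_add_eq_zero_right h0]
    exact hu
  have h := residual_inner_ge (hP.L_pos.trans hP.L_lt_Lhat) hP.Lhat_ρ
    (hT.1 _ _ _ _ (residual_mem hP hT Fi x) hu') (hF.inner_ge hP x xs)
  rw [sub_zero] at h
  have h2 := mul_nonneg hP.Lam_pos.le (meanSqDiff_nonneg Fi x xs)
  exact (le_add_of_nonneg_right h2).trans h

/-- The error of the residual computed from an estimate `f` of `F x`. -/
lemma norm_inexact_residual_sub_le {d n : ℕ} {P : Params} (hP : P.Admissible)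
    {T : E d → Set (E d)} (hT : IsMaxCoHypomonotone P.ρ T) (Fi : Fin n → E d → E d) (x f : E d) :
    ‖(1 / P.lam) • (x - resolvent T P.lam (x - P.lam • f)) - residual Fi T P.lam x‖ ^ 2 ≤
      ‖f - avg Fi x‖ ^ 2 :=
  norm_residual_sub_le hP.lam_lower hP.lam_pos
    (hT.1 _ _ _ _ (sub_mem_of_residual hT hP.ρ_lt_lam hP.lam_pos x f) (residual_mem hP hT Fi x))

/-! ### The one-step Lyapunov inequality -/

section Lyapunov

variable {E : Type*} [NormedAddCommGroup E] [InnerProductSpace ℝ E]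

/-- The weight of `‖z - x⋆‖²` in the Lyapunov function. It decreases in `t`, and the decrease
pays for the inner product of the error with `z - x⋆`. -/
def kappa (mu beta t : ℝ) : ℝ := (1 - mu) * (t - mu / 2) / (2 * mu * beta * (t - 1))

/-- The Lyapunov function `β s (s - 1) ‖G‖² + s ⟪G, x - z⟫ + κ(s + μ) ‖z - x⋆‖²`; at iteration `k`
it is used with `s = t_k - μ`. -/
def lyapunov (mu beta s : ℝ) (G x z xs : E) : ℝ :=
  beta * (s * (s - 1)) * ‖G‖ ^ 2 + s * inner ℝ G (x - z) + kappa mu beta (s + mu) * ‖z - xs‖ ^ 2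

lemma kappa_sub_kappa {mu beta t : ℝ} (hmu : 0 < mu) (hb : 0 < beta) (ht : 1 < t) :
    kappa mu beta t - kappa mu beta (t + mu) =
      (1 - mu) * (2 - mu) / (4 * beta * ((t - 1) * (t + mu - 1))) := by
  have h1 : t - 1 ≠ 0 := by linarith
  have h2 : t + mu - 1 ≠ 0 := by linarith
  unfold kappa
  field_simp
  ring

/-- The right-hand side is `t - μ/2` times the loss of the coefficient of `‖G‖²` in one step, when
`β = 1` and `β̄` is replaced by its lower bound `1 + μ`. -/
lemma gap_lower {mu t : ℝ} (hmu : 0 < mu) (hmu' : mu < 2 / 3) (ht : 1 + 3 * mu < t) :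
    2 / 3 * mu * t ≤ (2 - 3 * mu) * t ^ 2 + (3 / 2 * mu ^ 2 + 3 / 2 * mu - 1) * t - mu ^ 2 := by
  have h1 : 0 ≤ (2 - 3 * mu) * t * (t - (1 + 3 * mu)) :=
    mul_nonneg (mul_nonneg (by linarith) (by linarith)) (by linarith)
  have h2 : 0 ≤ 1 + 23 / 6 * mu - 15 / 2 * mu ^ 2 - mu ^ 2 * (1 / 3) := by nlinarith
  have h3 : 0 ≤ (1 + 23 / 6 * mu - 15 / 2 * mu ^ 2 - mu ^ 2 * (1 / 3)) * t :=
    mul_nonneg h2 (by linarith)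
  have h4 : 0 ≤ mu ^ 2 * (t * (1 / 3) - 1) + (2 / 3) * mu ^ 2 := by nlinarith [sq_nonneg mu]
  nlinarith

/-- The net loss of the coefficient of `‖G‖²` in one step, from below. -/
lemma gap_le {mu beta betaBar t : ℝ} (hmu : 0 < mu) (hmu' : mu < 2 / 3) (hb : 0 < beta)
    (hbb : beta * (2 + mu) ≤ (2 - mu) * betaBar) (ht : 1 + 3 * mu < t) :
    beta * (2 / 3 * mu * t / (t - mu / 2)) ≤
      beta * ((t - mu) * (t - mu - 1)) -
        (t * (t - 1) * (2 * beta * (t - 1) / (t - mu / 2) - beta) - (1 - mu) * betaBar +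
          (1 - mu) * (mu / 2) * (2 * beta * (t - 1) / (t - mu / 2)) / 2) := by
  have hs : 0 < t - mu / 2 := by linarith
  have hbb' : (1 + mu) * beta ≤ betaBar := by
    have : 0 ≤ (2 - mu) * (betaBar - (1 + mu) * beta) := by
      nlinarith [mul_pos hmu hb, mul_pos hmu (mul_pos hmu hb)]
    have := nonneg_of_mul_nonneg_right this (by linarith)
    linarith
  have h1 : (1 - mu) * ((1 + mu) * beta) ≤ (1 - mu) * betaBar :=
    mul_le_mul_of_nonneg_left hbb' (by linarith)
  have h2 := mul_le_mul_of_nonneg_left (gap_lower hmu hmu' ht) (div_pos hb hs).le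
  refine le_trans (le_of_eq ?_) (h2.trans ?_)
  · field_simp
  · have h3 : beta * ((t - mu) * (t - mu - 1)) -
        (t * (t - 1) * (2 * beta * (t - 1) / (t - mu / 2) - beta) - (1 - mu) * ((1 + mu) * beta) +
          (1 - mu) * (mu / 2) * (2 * beta * (t - 1) / (t - mu / 2)) / 2) =
        beta / (t - mu / 2) *
          ((2 - 3 * mu) * t ^ 2 + (3 / 2 * mu ^ 2 + 3 / 2 * mu - 1) * t - mu ^ 2) := by
      have : t * 2 - mu ≠ 0 := by linarith
      field_simp
      ring
    linarith

lemma kappa_sub_kappa_pos {mu beta t : ℝ} (hmu : 0 < mu) (hmu' : mu < 2 / 3) (hb : 0 < beta)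
    (ht : 1 < t) : 0 < kappa mu beta t - kappa mu beta (t + mu) := by
  rw [kappa_sub_kappa hmu hb ht]
  exact div_pos (mul_pos (by linarith) (by linarith))
    (mul_pos (by linarith) (mul_pos (by linarith) (by linarith)))

/-- The condition on the weights for the Young inequality between the error and `z' - x⋆`. -/
lemma young_kappa_coeff {mu beta t : ℝ} (hmu : 0 < mu) (hmu' : mu < 2 / 3) (hb : 0 < beta)
    (ht : 1 < t) :
    ((1 - mu) / 2) ^ 2 ≤
      (kappa mu beta t - kappa mu beta (t + mu)) * (beta * (t * (t - 1)) / 2) := by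
  have h1 : 0 < t - 1 := by linarith
  have h2 : 0 < t + mu - 1 := by linarith
  have h3 : (1 - mu) * (2 - mu) / (4 * beta * ((t - 1) * (t + mu - 1))) *
      (beta * (t * (t - 1)) / 2) = (1 - mu) / 4 * ((2 - mu) * t / (2 * (t + mu - 1))) := by
    field_simp
  rw [kappa_sub_kappa hmu hb ht, h3, div_pow,
    show ((1 - mu) ^ 2 / 2 ^ 2 : ℝ) = (1 - mu) / 4 * (1 - mu) by ring]
  apply mul_le_mul_of_nonneg_left _ (by linarith)
  rw [le_div_iff₀ (by linarith)]
  nlinarith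

/-- The condition on the weights for the Young inequality between the error and `G`; here
`q = (t - 1) / w` with `w = t - μ/2`, so that `η = 2βq`. -/
lemma young_residual_coeff {mu beta t w q : ℝ} (hmu : 0 < mu) (hmu' : mu < 2 / 3)
    (hb : 0 < beta) (ht : 0 < t) (hs : 0 < w) (hqw : q * w = t - 1) (hq0 : 0 < q) (hq1 : q ≤ 1)
    (hw : w = t - mu / 2) :
    (t * (t - 1) * (2 * beta - 2 * beta * q) / 2) ^ 2 ≤
      beta * (2 / 3 * mu * t / w) * (3 * beta / (2 * mu) * (t * (t - 1))) := by
  have h1 : t * (t - 1) * (2 * beta - 2 * beta * q) / 2 = beta * t * (q * (1 - mu / 2)) := by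
    rw [← hqw]
    linear_combination t * q * beta * (hw - hqw)
  have h2 : beta * (2 / 3 * mu * t / w) * (3 * beta / (2 * mu) * (t * (t - 1))) =
      (beta * t) ^ 2 * q := by
    rw [← hqw]; field_simp
  rw [h1, h2, mul_pow]
  refine mul_le_mul_of_nonneg_left ?_ (sq_nonneg _)
  have h3 : q * (1 - mu / 2) ≤ q := mul_le_of_le_one_right hq0.le (by linarith)
  have h5 : 0 ≤ q * (1 - mu / 2) := mul_nonneg hq0.le (by linarith)
  calc (q * (1 - mu / 2)) ^ 2 = q * (1 - mu / 2) * (q * (1 - mu / 2)) := sq _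
    _ ≤ q * 1 := mul_le_mul h3 (h3.trans hq1) h5 hq0.le
    _ = q := mul_one q

/-- The bookkeeping behind `lyapunov_step`: the identities for the update (`E1`–`E5`, `hk`), the
co-coercivity inequalities and the three Young inequalities, in terms of the norms and inner
products involved. -/
lemma lyapunov_step_scalar {mu beta bb t eta k kap kap' Q c1 c3 d1 d2 d3 B : ℝ}
    {α1 α2 P R S gg hh gh ge he ee gv ev vv zz N : ℝ}
    (htt : 0 ≤ t * (t - 1)) (hb : 0 ≤ beta) (hmu : 0 ≤ 1 - mu) (hk0 : 0 ≤ k)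
    (hgg : 0 ≤ gg) (hee : 0 ≤ ee) (hN : 0 ≤ N)
    (E1 : (t - 1) * α2 = P - 2 * beta * (t - 1) * (gh + he))
    (E2 : t * α1 = R - t * eta * (gg + ge))
    (E3 : zz = vv + 2 * k * (gv + ev) + k ^ 2 * (gg + 2 * ge + ee))
    (E4 : R = gv + k * (gg + ge) - S) (E5 : N = hh - 2 * gh + gg)
    (hk : kap * k = (1 - mu) / 2)
    (hG : bb * N + Q ≤ α2 - α1) (hGs : bb * gg ≤ S)
    (Y1 : 0 ≤ c1 * N + 2 * 1 * (he - ge) + d1 * ee)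
    (Y2 : 0 ≤ (kap - kap') * vv + 2 * ((1 - mu) / 2) * ev + d2 * ee)
    (Y3 : 0 ≤ c3 * gg + 2 * (t * (t - 1) * (2 * beta - eta) / 2) * ge + d3 * ee)
    (hB : beta * c1 ≤ bb - beta)
    (hgap : c3 ≤ beta * ((t - mu) * (t - mu - 1)) -
      (t * (t - 1) * (eta - beta) - (1 - mu) * bb + (1 - mu) * k / 2))
    (hd : beta * (t * (t - 1)) * d1 + d2 + d3 = B) :
    beta * (t * (t - 1)) * hh - t * P + kap' * vv + t * (t - 1) * Q ≤
      beta * ((t - mu) * (t - mu - 1)) * gg - (t - mu) * R + kap * zz + B * ee := by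
  have B1 := mul_le_mul_of_nonneg_left hB (mul_nonneg htt hN)
  have B2 := mul_le_mul_of_nonneg_right hgap hgg
  have B3 := mul_le_mul_of_nonneg_left hG htt
  have B4 := mul_le_mul_of_nonneg_left hGs hmu
  have B5 := mul_nonneg (mul_nonneg hb htt) Y1
  have B6 : 0 ≤ (1 - mu) * k / 2 * ee := by positivity
  linear_combination B3 + B4 + B1 + B2 + B5 + Y2 + Y3 + B6 + t * E1 - (t - 1) * E2 +
    (1 - mu) * E4 - kap * E3 - (2 * (gv + ev) + k * (gg + 2 * ge + ee)) * hk -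
    beta * (t * (t - 1)) * E5 + ee * hd

set_option maxHeartbeats 400000 in
/-- One step of the accelerated scheme with an inexact residual `Gt`. The error enters only through
`‖Gt - G‖²`: its inner product with `G' - G` is absorbed by the part of the co-coercivity of the
residual that `β < β̄` leaves unused, that with `z' - x⋆` by the decrease of `kappa`, and that
with `G` by the loss `gap_le` of the coefficient of `‖G‖²`. -/
lemma lyapunov_step {mu beta betaBar t Q δ : ℝ} (hmu : 0 < mu) (hmu' : mu < 2 / 3) (hb : 0 < beta)
    (hbb : beta * (2 + mu) ≤ (2 - mu) * betaBar) (ht : 1 + 3 * mu < t)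
    {x z xs x' z' G Gt G' : E}
    (hx' : x' = ((t - 1) / t) • x + (1 / t) • z - (2 * beta * (t - 1) / (t - mu / 2)) • Gt)
    (hz' : z' = z - (mu / 2 * (2 * beta * (t - 1) / (t - mu / 2))) • Gt)
    (hG : betaBar * ‖G' - G‖ ^ 2 + Q ≤ inner ℝ (G' - G) (x' - x))
    (hGs : betaBar * ‖G‖ ^ 2 ≤ inner ℝ G (x - xs)) (hδ : ‖Gt - G‖ ^ 2 ≤ δ) :
    lyapunov mu beta t G' x' z' xs + t * (t - 1) * Q ≤
      lyapunov mu beta (t - mu) G x z xs + 5 * beta / (2 * mu) * (t * (t - 1)) * δ := by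
  have ht0 : 0 < t := by linarith
  have ht1 : 0 < t - 1 := by linarith
  have htt : 0 < t * (t - 1) := mul_pos ht0 ht1
  have hs : 0 < t - mu / 2 := by linarith
  have hgap := gap_le hmu hmu' hb hbb ht
  set w := t - mu / 2 with hw
  set q := (t - 1) / w with hq
  have hq0 : 0 < q := div_pos ht1 hs
  have hq1 : q ≤ 1 := by rw [hq, div_le_one hs]; linarith
  have hqw : q * w = t - 1 := div_mul_cancel₀ _ hs.ne'
  have heta : 2 * beta * (t - 1) / w = 2 * beta * q := mul_div_assoc _ _ _
  rw [heta] at hx' hz' hgap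
  set eta := 2 * beta * q with heta'
  have heta0 : 0 < eta := by positivity
  have hetas : eta * w = 2 * beta * (t - 1) := by rw [heta', mul_assoc, hqw]
  obtain ⟨e, he⟩ : ∃ e, e = Gt - G := ⟨_, rfl⟩
  obtain ⟨v, hv⟩ : ∃ v, v = z' - xs := ⟨_, rfl⟩
  have hGt : Gt = G + e := by rw [he]; abel
  rw [← he] at hδ
  have hknu : kappa mu beta t * (mu / 2 * eta) = (1 - mu) / 2 := by
    have h1 : kappa mu beta t = (1 - mu) * w / (2 * mu * beta * (t - 1)) := rfl
    rw [h1, heta', ← hqw]; field_simp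
  -- The three forms of the update.
  have V1 : (t - 1) • (x' - x) = (z' - x') - (2 * beta * (t - 1)) • (G + e) := by
    have h1 : t • x' = (t - 1) • x + z - (t * eta) • Gt := by
      rw [hx', smul_sub, smul_add, smul_smul, smul_smul, smul_smul, mul_div_cancel₀ _ ht0.ne',
        mul_one_div_cancel ht0.ne', one_smul]
    have h2 : (t - 1) • (x' - x) = t • x' - x' - (t - 1) • x := by module
    rw [h2, h1, hz', ← hGt, ← hetas, hw]
    module
  have V2 : t • (x' - x) = (z - x) - (t * eta) • (G + e) := by
    rw [hx', ← hGt, smul_sub, smul_sub, smul_add, smul_smul, smul_smul, smul_smul,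
      mul_div_cancel₀ _ ht0.ne', mul_one_div_cancel ht0.ne', one_smul]
    module
  have V3 : z - xs = v + (mu / 2 * eta) • (G + e) := by
    rw [hv, hz', ← hGt]; module
  have E1 : (t - 1) * inner ℝ G' (x' - x) =
      inner ℝ G' (z' - x') - 2 * beta * (t - 1) * (inner ℝ G' G + inner ℝ G' e) := by
    rw [← real_inner_smul_right, V1, inner_sub_right, real_inner_smul_right, inner_add_right]
  have E2 : t * inner ℝ G (x' - x) =
      inner ℝ G (z - x) - t * eta * (‖G‖ ^ 2 + inner ℝ G e) := by
    rw [← real_inner_smul_right, V2, inner_sub_right, real_inner_smul_right, inner_add_right,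
      real_inner_self_eq_norm_sq]
  have E3 : ‖z - xs‖ ^ 2 = ‖v‖ ^ 2 + 2 * (mu / 2 * eta) * (inner ℝ G v + inner ℝ v e) +
      (mu / 2 * eta) ^ 2 * (‖G‖ ^ 2 + 2 * inner ℝ G e + ‖e‖ ^ 2) := by
    rw [V3, norm_add_sq_real, norm_smul, mul_pow, Real.norm_eq_abs, sq_abs, norm_add_sq_real,
      real_inner_smul_right, inner_add_right, real_inner_comm G v]
    ring
  have E4 : inner ℝ G (z - x) = inner ℝ G v + mu / 2 * eta * (‖G‖ ^ 2 + inner ℝ G e) -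
      inner ℝ G (x - xs) := by
    have : z - x = (z - xs) - (x - xs) := by abel
    rw [this, inner_sub_right, V3, inner_add_right, real_inner_smul_right, inner_add_right,
      real_inner_self_eq_norm_sq]
  -- The three applications of Young's inequality.
  have Y1 := young_inner (c := 2 * mu / (2 - mu)) (d := (2 - mu) / (2 * mu)) (p := 1)
    (div_pos (by linarith) (by linarith))
    (by have : 2 - mu ≠ 0 := by linarith
        rw [div_mul_div_cancel₀ (by positivity), div_self (by positivity), one_pow]) (G' - G) e
  rw [inner_sub_left] at Y1
  have Y2 := young_inner (c := kappa mu beta t - kappa mu beta (t + mu))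
    (d := beta * (t * (t - 1)) / 2) (p := (1 - mu) / 2)
    (kappa_sub_kappa_pos hmu hmu' hb (by linarith))
    (young_kappa_coeff hmu hmu' hb (by linarith)) v e
  have Y3 := young_inner (c := beta * (2 / 3 * mu * t / w))
    (d := 3 * beta / (2 * mu) * (t * (t - 1)))
    (p := t * (t - 1) * (2 * beta - eta) / 2)
    (by positivity)
    (young_residual_coeff hmu hmu' hb ht0 hs hqw hq0 hq1 hw) G e
  have hB : beta * (2 * mu / (2 - mu)) ≤ betaBar - beta := by
    rw [mul_div_assoc', div_le_iff₀ (by linarith)]; nlinarith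
  have hmain := lyapunov_step_scalar (B := 5 * beta / (2 * mu) * (t * (t - 1))) htt.le hb.le
    (show 0 ≤ 1 - mu by linarith) (by positivity) (sq_nonneg ‖G‖) (sq_nonneg ‖e‖)
    (sq_nonneg ‖G' - G‖) E1 E2 E3 E4
    (by rw [norm_sub_sq_real, real_inner_comm]) hknu
    (by rw [inner_sub_left] at hG; exact hG) hGs Y1 Y2 Y3 hB
    (hgap.trans_eq (by ring)) (by field_simp; ring)
  have hlast := mul_le_mul_of_nonneg_left hδ
    (show 0 ≤ 5 * beta / (2 * mu) * (t * (t - 1)) by positivity)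
  have F1 : inner ℝ G' (x' - z') = -inner ℝ G' (z' - x') := by rw [← inner_neg_right, neg_sub]
  have F2 : inner ℝ G (x - z) = -inner ℝ G (z - x) := by rw [← inner_neg_right, neg_sub]
  rw [lyapunov, lyapunov, F1, F2, sub_add_cancel, ← hv]
  linarith

/-- The Lyapunov function controls the residual. The factor is positive since `μ < 2 / 3`. -/
lemma le_lyapunov {mu beta betaBar s : ℝ} (hmu : 0 < mu) (hmu' : mu < 2 / 3) (hb : 0 < beta)
    (hbb : beta * (2 + mu) ≤ (2 - mu) * betaBar) (hs : 1 < s) {x z xs G : E}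
    (hGs : betaBar * ‖G‖ ^ 2 ≤ inner ℝ G (x - xs)) :
    beta * ((2 - 3 * mu) / (2 * (1 - mu))) * s ^ 2 * ‖G‖ ^ 2 ≤ lyapunov mu beta s G x z xs := by
  have hbb' : beta ≤ betaBar := by
    have : 0 ≤ (2 - mu) * (betaBar - beta) := by nlinarith [mul_pos hmu hb]
    have := nonneg_of_mul_nonneg_right this (by linarith)
    linarith
  have hk : 0 < kappa mu beta (s + mu) := by
    unfold kappa
    exact div_pos (mul_pos (by linarith) (by linarith))
      (mul_pos (by positivity) (by linarith))
  have hmu1 : 0 < 1 - mu := by linarith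
  have Y := young_inner (c := kappa mu beta (s + mu)) (d := beta * (mu / (2 * (1 - mu))) * s ^ 2)
    (p := -s / 2) hk
    (by have h1 : kappa mu beta (s + mu) * (beta * (mu / (2 * (1 - mu))) * s ^ 2) =
          s ^ 2 / 4 * ((s + mu / 2) / (s + mu - 1)) := by
          have : s + mu - 1 ≠ 0 := by linarith
          unfold kappa; field_simp; ring
        rw [h1, div_pow, neg_sq, show ((2 : ℝ) ^ 2) = 4 by norm_num]
        apply le_mul_of_one_le_right (by positivity)
        rw [one_le_div (by linarith)]
        linarith) (z - xs) G
  have h1 : x - z = (x - xs) - (z - xs) := by abel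
  have h2 : (2 - 3 * mu) / (2 * (1 - mu)) = 1 - mu / (2 * (1 - mu)) := by
    field_simp; ring
  have h3 := mul_le_mul_of_nonneg_left hGs (show 0 ≤ s by linarith)
  have h4 := mul_le_mul_of_nonneg_right hbb' (mul_nonneg (show 0 ≤ s by linarith) (sq_nonneg ‖G‖))
  rw [lyapunov, h1, inner_sub_right, h2, real_inner_comm (z - xs) G]
  linarith

end Lyapunov

/-! ### Expectations over finitely many independent draws -/

section Independence

variable {α : Type*} [Finite α] [MeasurableSpace α] [DiscreteMeasurableSpace α]
  {Ω : Type*} [MeasurableSpace Ω] {μ : Measure Ω} [IsProbabilityMeasure μ] {U : ℕ → Ω → α}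

lemma integrable_of_dependsOn (hU : ∀ k, Measurable (U k)) {k : ℕ} {f : (ℕ → α) → ℝ}
    (hf : DependsOn f (Set.Iic k)) : Integrable (fun w => f fun i => U i w) μ := by
  obtain ⟨g, rfl⟩ := dependsOn_iff_exists_comp.1 hf
  have hm : Measurable fun w => (Set.Iic k).domRestrict fun i => U i w :=
    measurable_pi_lambda _ fun i => hU i
  have hfin : Finite (Set.Iic k) := Set.finite_Iic k
  exact (Integrable.of_finite (μ := μ.map _) (f := g)).comp_measurable hm

/-- Independence lets the draw `k + 1` be averaged out with the earlier draws fixed. -/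
lemma integral_eq_integral_sum [Fintype α] (hU : ∀ k, Measurable (U k)) (hind : iIndepFun U μ)
    {k : ℕ} {g : α → (ℕ → α) → ℝ} (hg : ∀ v, DependsOn (g v) (Set.Iic k)) :
    ∫ w, g (U (k + 1) w) (fun i => U i w) ∂μ =
      ∫ w, ∑ v, μ.real {w | U (k + 1) w = v} * g v (fun i => U i w) ∂μ := by
  classical
  have hset : ∀ v, MeasurableSet {w | U (k + 1) w = v} := fun v =>
    hU (k + 1) (MeasurableSet.of_discrete (s := {v}))
  have hsplit : ∀ w, g (U (k + 1) w) (fun i => U i w) =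
      ∑ v, (if U (k + 1) w = v then (1 : ℝ) else 0) * g v (fun i => U i w) := fun w => by simp
  have hterm : ∀ v, ∫ w, (if U (k + 1) w = v then (1 : ℝ) else 0) * g v (fun i => U i w) ∂μ =
      μ.real {w | U (k + 1) w = v} * ∫ w, g v (fun i => U i w) ∂μ := by
    intro v
    have hg' : DependsOn (g v) (Finset.range (k + 1) : Set ℕ) := by
      have h := hg v
      rwa [show (Set.Iic k) = (Finset.range (k + 1) : Set ℕ) by
        ext i; simp] at h
    obtain ⟨φ, hφ⟩ := dependsOn_iff_exists_comp.1 hg'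
    have h1 := hind.indepFun_finset {k + 1} (Finset.range (k + 1)) (by simp) hU
    have h2 : IndepFun (fun w => if U (k + 1) w = v then (1 : ℝ) else 0)
        (fun w => g v (fun i => U i w)) μ := by
      have h3 := h1.comp (φ := fun p => if p ⟨k + 1, by simp⟩ = v then (1 : ℝ) else 0)
        (ψ := fun p => φ p) .of_discrete .of_discrete
      rw [hφ]
      exact h3
    rw [h2.integral_fun_mul_eq_mul_integral]
    · congr 1
      have : (fun w => if U (k + 1) w = v then (1 : ℝ) else 0) =
          Set.indicator {w | U (k + 1) w = v} 1 := by
        ext w; simp [Set.indicator_apply]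
      rw [this, integral_indicator_one (hset v)]
    · exact (Measurable.ite (hset v) measurable_const measurable_const).aestronglyMeasurable
    · exact (integrable_of_dependsOn hU (hg v)).aestronglyMeasurable
  simp_rw [hsplit]
  rw [integral_finsetSum, integral_finsetSum]
  · refine Finset.sum_congr rfl fun v _ => ?_
    rw [hterm, integral_const_mul]
  · exact fun v _ => (integrable_of_dependsOn hU (hg v)).const_mul _
  · intro v _
    refine (integrable_of_dependsOn hU (hg v)).bdd_mul (c := 1)
      (Measurable.ite (hset v) measurable_const measurable_const).aestronglyMeasurable ?_
    exact Filter.Eventually.of_forall fun w => by split_ifs <;> simp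

lemma integral_next_le [Fintype α] (hU : ∀ k, Measurable (U k)) (hind : iIndepFun U μ)
    {k : ℕ} {g : α → (ℕ → α) → ℝ} (hg : ∀ v, DependsOn (g v) (Set.Iic k)) {f : (ℕ → α) → ℝ}
    (hf : DependsOn f (Set.Iic k))
    (hfg : ∀ u, ∑ v, μ.real {w | U (k + 1) w = v} * g v u ≤ f u) :
    ∫ w, g (U (k + 1) w) (fun i => U i w) ∂μ ≤ ∫ w, f (fun i => U i w) ∂μ := by
  rw [integral_eq_integral_sum hU hind hg]
  exact integral_mono (integrable_finsetSum _ fun v _ =>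
    (integrable_of_dependsOn hU (hg v)).const_mul _) (integrable_of_dependsOn hU hf)
    fun w => hfg _

end Independence

/-! ### The variance of the loopless-SARAH estimator -/

/-- The second moment of a fixed vector plus a sum of `b` i.i.d. centred vectors. -/
lemma sum_norm_add_sum_sq {E : Type*} [NormedAddCommGroup E] [InnerProductSpace ℝ E] {n : ℕ}
    (hn : 0 < n) (Y : Fin n → E) (hY : ∑ i, Y i = 0) (b : ℕ) (e : E) :
    ∑ s : Fin b → Fin n, (1 / (n : ℝ)) ^ b * ‖e + ∑ j, Y (s j)‖ ^ 2 =
      ‖e‖ ^ 2 + b * (1 / (n : ℝ) * ∑ i, ‖Y i‖ ^ 2) := by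
  have hn' : (n : ℝ) ≠ 0 := by exact_mod_cast hn.ne'
  induction b generalizing e with
  | zero => simp
  | succ b ih =>
    rw [← (Fin.consEquiv (fun _ : Fin (b + 1) => Fin n)).sum_comp, Fintype.sum_prod_type]
    have h1 : ∀ (i : Fin n), ∑ s : Fin b → Fin n, (1 / (n : ℝ)) ^ (b + 1) *
        ‖e + ∑ j, Y ((Fin.consEquiv (fun _ : Fin (b + 1) => Fin n)) (i, s) j)‖ ^ 2 =
        1 / (n : ℝ) * (‖e + Y i‖ ^ 2 + b * (1 / (n : ℝ) * ∑ i, ‖Y i‖ ^ 2)) := by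
      intro i
      rw [← ih (e + Y i), Finset.mul_sum]
      refine Finset.sum_congr rfl fun s _ => ?_
      rw [Fin.sum_univ_succ]
      simp only [Fin.consEquiv, Equiv.coe_fn_mk, Fin.cons_zero, Fin.cons_succ]
      rw [pow_succ, add_assoc]
      ring
    rw [Finset.sum_congr rfl fun i _ => h1 i]
    have h2 : ∑ i, ‖e + Y i‖ ^ 2 = n * ‖e‖ ^ 2 + ∑ i, ‖Y i‖ ^ 2 := by
      simp only [norm_add_sq_real, Finset.sum_add_distrib, ← Finset.mul_sum, ← inner_sum, hY]
      simp
    rw [← Finset.mul_sum, Finset.sum_add_distrib, h2]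
    simp only [Finset.sum_const, Finset.card_univ, Fintype.card_fin, nsmul_eq_mul]
    push_cast
    field_simp
    ring

lemma sum_norm_sub_mean_sq_le {E : Type*} [NormedAddCommGroup E] [InnerProductSpace ℝ E] {n : ℕ}
    (hn : 0 < n) (D : Fin n → E) :
    ∑ i, ‖D i - (1 / (n : ℝ)) • ∑ j, D j‖ ^ 2 ≤ ∑ i, ‖D i‖ ^ 2 := by
  have hn' : (n : ℝ) ≠ 0 := by exact_mod_cast hn.ne'
  set m := (1 / (n : ℝ)) • ∑ j, D j with hm
  have hS : ∑ j, D j = (n : ℝ) • m := by rw [hm, smul_smul, mul_one_div_cancel hn', one_smul]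
  have : ∑ i, ‖D i - m‖ ^ 2 = ∑ i, ‖D i‖ ^ 2 - n * ‖m‖ ^ 2 := by
    simp only [norm_sub_sq_real, Finset.sum_add_distrib, Finset.sum_sub_distrib, ← Finset.mul_sum,
      ← sum_inner, hS, real_inner_smul_left, real_inner_self_eq_norm_sq]
    simp
    ring
  rw [this]
  have : 0 ≤ (n : ℝ) * ‖m‖ ^ 2 := by positivity
  linarith

/-- The conditional mean square error of the mini-batch branch of the estimator. -/
lemma sum_batch_error_le {d n b : ℕ} (hn : 0 < n) (hb : 0 < b) (Fi : Fin n → E d → E d)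
    (Fold xold xnew : E d) :
    ∑ s : Fin b → Fin n,
      (1 / (n : ℝ)) ^ b * ‖sarah Fi (false, s) Fold xold xnew - avg Fi xnew‖ ^ 2 ≤
      ‖Fold - avg Fi xold‖ ^ 2 + 1 / (b : ℝ) * meanSqDiff Fi xnew xold := by
  have hn' : (n : ℝ) ≠ 0 := by exact_mod_cast hn.ne'
  have hb' : (b : ℝ) ≠ 0 := by exact_mod_cast hb.ne'
  set D : Fin n → E d := fun i => Fi i xnew - Fi i xold with hD
  set m : E d := (1 / (n : ℝ)) • ∑ i, D i with hm
  have hm' : m = avg Fi xnew - avg Fi xold := by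
    rw [hm, hD, avg, avg, ← smul_sub, Finset.sum_sub_distrib]
  have h1 : ∀ s : Fin b → Fin n, sarah Fi (false, s) Fold xold xnew - avg Fi xnew =
      (Fold - avg Fi xold) + ∑ j, (1 / (b : ℝ)) • (D (s j) - m) := by
    intro s
    have h2 : ∑ j, (1 / (b : ℝ)) • (D (s j) - m) =
        (1 / (b : ℝ)) • ∑ j, Fi (s j) xnew - (1 / (b : ℝ)) • ∑ j, Fi (s j) xold - m := by
      rw [← Finset.smul_sum, Finset.sum_sub_distrib, Finset.sum_const, Finset.card_univ,
        Fintype.card_fin, ← Nat.cast_smul_eq_nsmul ℝ, smul_sub, smul_smul,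
        one_div_mul_cancel hb', one_smul, hD, Finset.sum_sub_distrib, smul_sub]
    rw [h2, hm', sarah]
    simp only [Bool.false_eq_true, if_false]
    abel
  have h3 : ∑ i, (1 / (b : ℝ)) • (D i - m) = 0 := by
    rw [← Finset.smul_sum, Finset.sum_sub_distrib, Finset.sum_const, Finset.card_univ,
      Fintype.card_fin, ← Nat.cast_smul_eq_nsmul ℝ, hm, smul_smul, mul_one_div_cancel hn',
      one_smul, sub_self, smul_zero]
  simp_rw [h1]
  rw [sum_norm_add_sum_sq hn _ h3]
  refine add_le_add le_rfl ?_
  simp_rw [norm_smul, mul_pow, Real.norm_eq_abs, sq_abs]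
  rw [← Finset.mul_sum, meanSqDiff]
  have h4 := sum_norm_sub_mean_sq_le hn D
  rw [← hm] at h4
  calc (b : ℝ) * (1 / n * ((1 / (b : ℝ)) ^ 2 * ∑ i, ‖D i - m‖ ^ 2))
      = 1 / b * (1 / n * ∑ i, ‖D i - m‖ ^ 2) := by field_simp
    _ ≤ 1 / b * (1 / n * ∑ i, ‖D i‖ ^ 2) := by gcongr

/-- The probability of a draw, when the coin shows `true` with probability `p`. -/
def drawProb {n b : ℕ} (p : ℝ) (v : Draw n b) : ℝ :=
  (if v.1 = true then p else 1 - p) * (1 / (n : ℝ)) ^ b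

lemma sum_drawProb_mul {n b : ℕ} (p : ℝ) (f : Draw n b → ℝ) :
    ∑ v, drawProb p v * f v =
      p * ∑ s : Fin b → Fin n, (1 / (n : ℝ)) ^ b * f (true, s) +
      (1 - p) * ∑ s : Fin b → Fin n, (1 / (n : ℝ)) ^ b * f (false, s) := by
  rw [Fintype.sum_prod_type, Fintype.sum_bool]
  simp only [drawProb, if_true, Bool.false_eq_true, if_false, mul_assoc, Finset.mul_sum]

lemma sum_uniform {n b : ℕ} (hn : 0 < n) :
    ∑ _s : Fin b → Fin n, (1 / (n : ℝ)) ^ b = 1 := by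
  have hn' : (n : ℝ) ≠ 0 := by exact_mod_cast hn.ne'
  simp [Finset.card_univ, hn']

lemma sum_sarah_error_le {d n b : ℕ} (hn : 0 < n) (hb : 0 < b) {p : ℝ} (hp : p ≤ 1)
    (Fi : Fin n → E d → E d) (Fold xold xnew : E d) :
    ∑ v : Draw n b, drawProb p v * ‖sarah Fi v Fold xold xnew - avg Fi xnew‖ ^ 2 ≤
      (1 - p) * (‖Fold - avg Fi xold‖ ^ 2 + 1 / (b : ℝ) * meanSqDiff Fi xnew xold) := by
  rw [sum_drawProb_mul]
  have h : ∀ s : Fin b → Fin n, sarah Fi (true, s) Fold xold xnew - avg Fi xnew = 0 := fun s => by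
    simp [sarah]
  simp only [h, norm_zero]
  have := mul_le_mul_of_nonneg_left (sum_batch_error_le hn hb Fi Fold xold xnew)
    (sub_nonneg.2 hp)
  simpa using this

/-! ### Descent of the potential in expectation -/

/-- The point `x^{k+1}`, which depends on the past only through the state at iteration `k`. -/
def nextX {d : ℕ} (P : Params) (T : E d → Set (E d)) (k : ℕ) (s : State d) : E d :=
  ((P.t k - 1) / P.t k) • s.x + (1 / P.t k) • s.z -
    P.eta k • ((1 / P.lam) • (s.x - resolvent T P.lam (s.x - P.lam • s.Ft)))

/-- The point `z^{k+1}` as a function of the state at iteration `k`. -/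
def nextZ {d : ℕ} (P : Params) (T : E d → Set (E d)) (k : ℕ) (s : State d) : E d :=
  s.z + P.nu • (nextX P T k s - (((P.t k - 1) / P.t k) • s.x + (1 / P.t k) • s.z))

/-- The state at iteration `k + 1` obtained from the state `s` with the draw `v`. -/
def nextState {d n b : ℕ} (P : Params) (Fi : Fin n → E d → E d) (T : E d → Set (E d)) (k : ℕ)
    (s : State d) (v : Draw n b) : State d :=
  ⟨nextX P T k s, nextZ P T k s, sarah Fi v s.Ft s.x (nextX P T k s)⟩

lemma iter_succ {d n b : ℕ} (P : Params) (Fi : Fin n → E d → E d) (T : E d → Set (E d))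
    (x0 : E d) (u : ℕ → Draw n b) (k : ℕ) :
    iter P Fi T x0 u (k + 1) = nextState P Fi T k (iter P Fi T x0 u k) (u (k + 1)) := rfl

lemma dependsOn_iter {d n b : ℕ} (P : Params) (Fi : Fin n → E d → E d) (T : E d → Set (E d))
    (x0 : E d) (k : ℕ) :
    DependsOn (fun u : ℕ → Draw n b => iter P Fi T x0 u k) (Set.Iic k) := by
  induction k with
  | zero => intro u u' _; rfl
  | succ k ih =>
    intro u u' h
    simp only [iter_succ]
    rw [h (k + 1) (Set.mem_Iic.2 le_rfl)]
    congr 1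
    exact ih fun i hi => h i (Set.mem_Iic.2 ((Set.mem_Iic.1 hi).trans k.le_succ))

/-- The Lyapunov function at iteration `k` plus the weighted squared error of the estimator. -/
def potential {d n : ℕ} (P : Params) (Fi : Fin n → E d → E d) (T : E d → Set (E d)) (xs : E d)
    (b k : ℕ) (s : State d) : ℝ :=
  lyapunov P.mu P.beta (P.t k - P.mu) (residual Fi T P.lam s.x) s.x s.z xs +
    b * P.Lam * (P.t k * (P.t k - 1)) * ‖s.Ft - avg Fi s.x‖ ^ 2

namespace Params

variable {P : Params}

lemma t_succ (k : ℕ) : P.t (k + 1) = P.t k + P.mu := by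
  unfold t; push_cast; ring

lemma Admissible.mu_mul_r_gt (hP : P.Admissible) : 1 + 3 * P.mu < P.mu * P.r := by
  have h1 := mul_lt_mul_of_pos_left hP.r_gt hP.mu_pos
  have h2 : P.mu * (3 + 1 / P.mu) = 1 + 3 * P.mu := by
    have := hP.mu_pos.ne'
    field_simp; ring
  linarith

lemma Admissible.t_gt (hP : P.Admissible) (k : ℕ) : 1 + 3 * P.mu < P.t k := by
  have h1 := hP.mu_mul_r_gt
  have h2 : 0 ≤ P.mu * k := mul_nonneg hP.mu_pos.le (Nat.cast_nonneg k)
  unfold t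
  linarith

lemma Admissible.beta_mul_le (hP : P.Admissible) :
    P.beta * (2 + P.mu) ≤ (2 - P.mu) * P.betaBar := by
  have h1 := hP.beta_le
  have := hP.mu_pos
  rwa [le_div_iff₀ (by linarith)] at h1

lemma Admissible.rpow_pos {ω : ℝ} {n : ℕ} (hn : P.LargeEnough ω n) : 0 < (n : ℝ) ^ ω :=
  Real.rpow_pos_of_pos (by exact_mod_cast hn.pos) ω

lemma Admissible.cb_pos (hP : P.Admissible) : 0 < P.cb :=
  div_pos (mul_pos (mul_pos (by norm_num) hP.beta_pos) hP.cp_pos) (mul_pos hP.mu_pos hP.Lam_pos)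

lemma Admissible.batch_le (hP : P.Admissible) {ω : ℝ} {n : ℕ} (hn : P.LargeEnough ω n) :
    (P.batch ω n : ℝ) ≤ P.cb * (n : ℝ) ^ ω :=
  Nat.floor_le (mul_pos hP.cb_pos (rpow_pos hn)).le

/-- Rounding at most halves the batch size, which is therefore large enough for the variance to be
paid by the surplus `Λ` of the co-coercivity. -/
lemma Admissible.batch_ge (hP : P.Admissible) {ω : ℝ} {n : ℕ} (hn : P.LargeEnough ω n) :
    5 * P.beta / (2 * P.mu) ≤ P.batch ω n * P.Lam * (1 / (P.cp * (n : ℝ) ^ ω)) := by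
  have h1 : P.cb * (n : ℝ) ^ ω < P.batch ω n + 1 := Nat.lt_floor_add_one _
  have h2 : (1 : ℝ) ≤ P.batch ω n := by exact_mod_cast hn.batch_pos
  have h3 : P.cb * (n : ℝ) ^ ω / 2 ≤ P.batch ω n := by linarith
  have hN := rpow_pos hn
  have hc := hP.cp_pos
  have hL := hP.Lam_pos
  have hm := hP.mu_pos
  calc 5 * P.beta / (2 * P.mu)
      = P.cb * (n : ℝ) ^ ω / 2 * P.Lam * (1 / (P.cp * (n : ℝ) ^ ω)) := by
        unfold cb; field_simp
    _ ≤ _ := by gcongr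

lemma lt_of_K0_lt {ω : ℝ} {n k : ℕ} (h : ¬ ((k : ℤ) ≤ P.K0 ω n)) :
    2 * P.cp * (n : ℝ) ^ ω < k + P.r - 1 - 1 / P.mu := by
  rw [K0, Int.le_floor] at h
  push_cast at h
  linarith

/-- In both branches of its definition the switching probability compensates the growth of the
weight of the estimator error. -/
lemma Admissible.prob_ge (hP : P.Admissible) {ω : ℝ} {n : ℕ} (hn : P.LargeEnough ω n) (k : ℕ) :
    1 / (P.cp * (n : ℝ) ^ ω) + 2 * P.mu / (P.t k - 1) ≤ P.prob ω n (k + 1) := by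
  have hN := rpow_pos hn
  have hc := hP.cp_pos
  have hm := hP.mu_pos
  have ht : P.mu * (((k + 1 : ℕ) : ℝ) + P.r - 1) - 1 = P.t k - 1 := by
    unfold t; push_cast; ring
  have ht1 := hP.t_gt k
  rw [prob]
  split_ifs with h
  · rw [ht]
  · have h1 := mul_lt_mul_of_pos_left (lt_of_K0_lt h) hm
    have h2 : P.mu * (((k + 1 : ℕ) : ℝ) + P.r - 1 - 1 / P.mu) = P.t k - 1 := by
      rw [← ht]; field_simp
    rw [h2] at h1
    have h3 : 2 * P.mu / (P.t k - 1) ≤ 1 / (P.cp * (n : ℝ) ^ ω) := by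
      rw [div_le_div_iff₀ (by linarith) (by positivity)]
      linarith
    have h4 : 2 / (P.cp * (n : ℝ) ^ ω) = 1 / (P.cp * (n : ℝ) ^ ω) + 1 / (P.cp * (n : ℝ) ^ ω) := by
      ring
    linarith

end Params

/-- The weight `t_{k+1} (t_{k+1} - 1)` of the next estimator error, times the probability of keeping
the old estimator, is a contraction of `t_k (t_k - 1)` with the rate `a = 1 / (c_p n^ω)`. -/
lemma weight_contraction {t mu a p : ℝ} (hmu : 0 < mu) (ht : 1 < t) (ha : 0 ≤ a) (hp1 : p ≤ 1)
    (hp : a + 2 * mu / (t - 1) ≤ p) :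
    (t + mu) * (t + mu - 1) * (1 - p) ≤ t * (t - 1) * (1 - a) := by
  have h1 : 0 < t - 1 := by linarith
  obtain ⟨c, hc⟩ : ∃ c, c = mu / (t - 1) := ⟨_, rfl⟩
  have hc0 : 0 < c := by rw [hc]; positivity
  have hcm : c * (t - 1) = mu := by rw [hc]; exact div_mul_cancel₀ _ h1.ne'
  rw [mul_div_assoc, ← hc] at hp
  have h2 : t + mu ≤ t * (1 + c) := by nlinarith
  have h3 : t + mu - 1 = (t - 1) * (1 + c) := by linarith
  calc (t + mu) * (t + mu - 1) * (1 - p)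
      ≤ t * (1 + c) * ((t - 1) * (1 + c)) * (1 - p) := by
        rw [h3]
        have : 0 ≤ 1 - p := by linarith
        gcongr
    _ = t * (t - 1) * ((1 + c) ^ 2 * (1 - p)) := by ring
    _ ≤ t * (t - 1) * ((1 + c) ^ 2 * (1 - (a + 2 * c))) := by
        have : 0 ≤ t * (t - 1) := by positivity
        gcongr
    _ ≤ t * (t - 1) * (1 - a) := by
        have : 0 ≤ t * (t - 1) := by positivity
        apply mul_le_mul_of_nonneg_left _ this
        have h4 : 0 ≤ a * c + a * c ^ 2 + c ^ 2 + c ^ 3 := by positivity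
        nlinarith

lemma sum_drawProb {n b : ℕ} (hn : 0 < n) (p : ℝ) : ∑ v : Draw n b, drawProb p v = 1 := by
  have h := sum_drawProb_mul (n := n) (b := b) p fun _ => 1
  simp only [mul_one, sum_uniform hn] at h
  linarith

/-- The conditional expectation of the potential at iteration `k + 1`, given the state `s` at
iteration `k`, is at most the potential of `s`. -/
lemma sum_drawProb_potential_le {d n : ℕ} {P : Params} (hP : P.Admissible) {ω : ℝ}
    (hn : P.LargeEnough ω n) {Fi : Fin n → E d → E d} {T : E d → Set (E d)}
    (hF : IsAverageCocoercive P.L Fi) (hT : IsMaxCoHypomonotone P.ρ T) {xs : E d}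
    (hxs : IsSolution Fi T xs) (k : ℕ) (hp1 : P.prob ω n (k + 1) ≤ 1) (s : State d) :
    ∑ v : Draw n (P.batch ω n), drawProb (P.prob ω n (k + 1)) v *
      potential P Fi T xs (P.batch ω n) (k + 1) (nextState P Fi T k s v) ≤
      potential P Fi T xs (P.batch ω n) k s := by
  have hb : 0 < P.batch ω n := hn.batch_pos
  have hb' : (0 : ℝ) < P.batch ω n := by exact_mod_cast hb
  have ht := hP.t_gt k
  have hmu := hP.mu_pos
  have hL := hP.Lam_pos
  set x' := nextX P T k s with hx'
  set p := P.prob ω n (k + 1) with hp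
  have hstep := lyapunov_step hP.mu_pos hP.mu_lt hP.beta_pos hP.beta_mul_le ht
    (x := s.x) (z := s.z) (x' := x') (z' := nextZ P T k s)
    (Gt := (1 / P.lam) • (s.x - resolvent T P.lam (s.x - P.lam • s.Ft))) rfl
    (by simp only [nextZ, nextX, Params.eta, Params.nu]; module)
    (residual_cocoercive hP hF hT x' s.x) (residual_cocoercive_solution hP hF hT hxs s.x)
    (norm_inexact_residual_sub_le hP hT Fi s.x s.Ft)
  have hvar := sum_sarah_error_le (b := P.batch ω n) hn.pos hb hp1 Fi s.Ft s.x x'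
  have hN := Params.Admissible.rpow_pos hn
  have hc := hP.cp_pos
  set a := 1 / (P.cp * (n : ℝ) ^ ω) with ha
  have ha0 : 0 ≤ a := by positivity
  have hcontr := weight_contraction hmu (show 1 < P.t k by linarith) ha0 hp1 (hP.prob_ge hn k)
  have hbatch : 5 * P.beta / (2 * P.mu) ≤ P.batch ω n * P.Lam * a := hP.batch_ge hn
  have hsplit : ∑ v : Draw n (P.batch ω n), drawProb p v *
      potential P Fi T xs (P.batch ω n) (k + 1) (nextState P Fi T k s v) =
      lyapunov P.mu P.beta (P.t k) (residual Fi T P.lam x') x' (nextZ P T k s) xs +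
      P.batch ω n * P.Lam * ((P.t k + P.mu) * (P.t k + P.mu - 1)) *
        ∑ v : Draw n (P.batch ω n),
          drawProb p v * ‖sarah Fi v s.Ft s.x x' - avg Fi x'‖ ^ 2 := by
    simp only [potential, nextState, Params.t_succ, add_sub_cancel_right, mul_add,
      Finset.sum_add_distrib, ← Finset.sum_mul, sum_drawProb hn.pos, one_mul, Finset.mul_sum]
    congr 1
    refine Finset.sum_congr rfl fun v _ => by ring
  rw [hsplit, potential]
  set e2 := ‖s.Ft - avg Fi s.x‖ ^ 2 with he2
  set D := meanSqDiff Fi x' s.x with hD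
  have hD0 : 0 ≤ D := meanSqDiff_nonneg Fi _ _
  set W := (P.batch ω n : ℝ) * P.Lam with hW
  have hW0 : 0 < W := mul_pos hb' hL
  have htt : 0 < P.t k * (P.t k - 1) := mul_pos (by linarith) (by linarith)
  have htt' : 0 ≤ (P.t k + P.mu) * (P.t k + P.mu - 1) := mul_nonneg (by linarith) (by linarith)
  have he0 : 0 ≤ e2 + 1 / (P.batch ω n : ℝ) * D := by positivity
  have h1 := mul_le_mul_of_nonneg_left hvar (mul_nonneg hW0.le htt')
  have h2 := mul_le_mul_of_nonneg_left (mul_le_mul_of_nonneg_right hcontr he0) hW0.le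
  have h3 : W * (P.t k * (P.t k - 1) * (1 - a) * (e2 + 1 / (P.batch ω n : ℝ) * D)) =
      P.t k * (P.t k - 1) * (W * e2 - W * a * e2) + P.t k * (P.t k - 1) * (1 - a) * (P.Lam * D) := by
    rw [hW]; field_simp
  have h4 : P.t k * (P.t k - 1) * (1 - a) * (P.Lam * D) ≤ P.t k * (P.t k - 1) * (P.Lam * D) := by
    have : 0 ≤ P.t k * (P.t k - 1) * (P.Lam * D) * a := by positivity
    linarith
  have h5 := mul_le_mul_of_nonneg_right hbatch (mul_nonneg htt.le (sq_nonneg ‖s.Ft - avg Fi s.x‖))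
  rw [← he2] at h5
  linarith

lemma IsSarahSampling.measureReal_eq {n b : ℕ} {Ω : Type*} [MeasurableSpace Ω]
    {μ : Measure Ω} {p : ℕ → ℝ} {U : ℕ → Ω → Draw n b}
    (hU : IsSarahSampling μ p U) (k : ℕ) (v : Draw n b) :
    μ.real {w | U k w = v} = drawProb (p k) v := hU.law k v.1 v.2

lemma IsSarahSampling.prob_mem {n b : ℕ} {Ω : Type*} [MeasurableSpace Ω]
    {μ : Measure Ω} {p : ℕ → ℝ} {U : ℕ → Ω → Draw n b}
    (hU : IsSarahSampling μ p U) (hn : 0 < n) (k : ℕ) : 0 ≤ p k ∧ p k ≤ 1 := by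
  have hn' : (0 : ℝ) < n := by exact_mod_cast hn
  have hq : 0 < (1 / (n : ℝ)) ^ b := by positivity
  have h1 : 0 ≤ p k * (1 / (n : ℝ)) ^ b := by
    have h := hU.law k true fun _ => ⟨0, hn⟩
    rw [if_pos rfl] at h
    exact h ▸ measureReal_nonneg
  have h2 : 0 ≤ (1 - p k) * (1 / (n : ℝ)) ^ b := by
    have h := hU.law k false fun _ => ⟨0, hn⟩
    rw [if_neg (by simp)] at h
    exact h ▸ measureReal_nonneg
  exact ⟨nonneg_of_mul_nonneg_left h1 hq, by linarith [nonneg_of_mul_nonneg_left h2 hq]⟩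

section Expectation

variable {d n : ℕ} {P : Params} {ω : ℝ} {Fi : Fin n → E d → E d} {T : E d → Set (E d)}
  {Ω : Type*} [MeasurableSpace Ω] {μ : Measure Ω} [IsProbabilityMeasure μ]

lemma integrable_iter {b : ℕ} {p : ℕ → ℝ} {U : ℕ → Ω → Draw n b} (hU : IsSarahSampling μ p U)
    (P : Params) (Fi : Fin n → E d → E d) (T : E d → Set (E d)) (x0 : E d) (k : ℕ)
    (f : State d → ℝ) : Integrable (fun w => f (iter P Fi T x0 (fun i => U i w) k)) μ :=
  integrable_of_dependsOn hU.measurable (k := k) (f := fun u => f (iter P Fi T x0 u k))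
    fun _ _ h => congrArg f (dependsOn_iter P Fi T x0 k h)

lemma integral_potential_le (hP : P.Admissible) (hn : P.LargeEnough ω n)
    (hF : IsAverageCocoercive P.L Fi) (hT : IsMaxCoHypomonotone P.ρ T) {xs : E d}
    (hxs : IsSolution Fi T xs) (x0 : E d) {U : ℕ → Ω → Draw n (P.batch ω n)}
    (hU : IsSarahSampling μ (P.prob ω n) U) (k : ℕ) :
    ∫ w, potential P Fi T xs (P.batch ω n) k (iter P Fi T x0 (fun i => U i w) k) ∂μ ≤
      potential P Fi T xs (P.batch ω n) 0 ⟨x0, x0, avg Fi x0⟩ := by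
  induction k with
  | zero => simp [iter]
  | succ k ih =>
    refine le_trans ?_ ih
    simp only [iter_succ]
    have hdep := dependsOn_iter (b := P.batch ω n) P Fi T x0 k
    refine integral_next_le hU.measurable hU.indep (k := k)
      (g := fun v u => potential P Fi T xs (P.batch ω n) (k + 1)
        (nextState P Fi T k (iter P Fi T x0 u k) v))
      (f := fun u => potential P Fi T xs (P.batch ω n) k (iter P Fi T x0 u k))
      (fun v u u' h => ?_) (fun u u' h => ?_) fun u => ?_
    · exact congrArg (fun s => potential P Fi T xs _ (k + 1) (nextState P Fi T k s v)) (hdep h)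
    · exact congrArg (fun s => potential P Fi T xs _ k s) (hdep h)
    · simp only [hU.measureReal_eq]
      exact sum_drawProb_potential_le hP hn hF hT hxs k (hU.prob_mem hn.pos (k + 1)).2 _

end Expectation

lemma psi0_nonneg {d n : ℕ} (P : Params) (Fi : Fin n → E d → E d) (T : E d → Set (E d))
    (x0 xs : E d) : 0 ≤ P.Psi0 Fi T x0 xs := Real.sqrt_nonneg _

lemma potential_zero_le {d n : ℕ} {P : Params} (hP : P.Admissible) (Fi : Fin n → E d → E d)
    (T : E d → Set (E d)) (x0 xs : E d) (b : ℕ) :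
    potential P Fi T xs b 0 ⟨x0, x0, avg Fi x0⟩ ≤ P.beta * P.Psi0 Fi T x0 xs ^ 2 := by
  have hmr := hP.mu_mul_r_gt
  have hmu := hP.mu_pos
  have hmu' := hP.mu_lt
  have hb := hP.beta_pos
  have h2r : 0 < 2 * P.r - 1 := by
    have h1 := hP.r_gt
    have h2 : 0 < 1 / P.mu := one_div_pos.2 hmu
    linarith
  have hc : 0 ≤ (2 * P.r - 1) / (4 * P.beta ^ 2 * (P.mu * P.r - 1)) :=
    div_nonneg h2r.le (mul_nonneg (by positivity) (by linarith))
  rw [Params.Psi0, Real.sq_sqrt (by positivity), potential, lyapunov]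
  simp only [sub_self, norm_zero, inner_zero_right, mul_zero, add_zero, sub_add_cancel]
  have ht0 : P.t 0 = P.mu * P.r := by simp [Params.t]
  rw [ht0]
  have h1 : (P.mu * P.r - P.mu) * (P.mu * P.r - P.mu - 1) ≤ P.mu ^ 2 * P.r ^ 2 := by nlinarith
  have h2 : kappa P.mu P.beta (P.mu * P.r) ≤
      P.beta * ((2 * P.r - 1) / (4 * P.beta ^ 2 * (P.mu * P.r - 1))) := by
    have h4 : 0 < P.mu * P.r - 1 := by linarith
    have h3 : kappa P.mu P.beta (P.mu * P.r) =
        (1 - P.mu) * (P.beta * ((2 * P.r - 1) / (4 * P.beta ^ 2 * (P.mu * P.r - 1)))) := by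
      unfold kappa; field_simp; ring
    rw [h3]
    exact mul_le_of_le_one_left (mul_nonneg hb.le hc) (by linarith)
  have h3 := mul_le_mul_of_nonneg_right h2 (sq_nonneg ‖x0 - xs‖)
  have h4 := mul_le_mul_of_nonneg_left (mul_le_mul_of_nonneg_right h1
    (sq_nonneg ‖residual Fi T P.lam x0‖)) hb.le
  nlinarith

/-! ### The convergence rate -/

lemma Params.Cmu_nonneg (P : Params) : 0 ≤ P.Cmu :=
  (Real.sqrt_nonneg 2).trans (le_max_left _ _)

lemma Params.Admissible.one_le_Cmu_sq {P : Params} (hP : P.Admissible) :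
    1 ≤ (2 - 3 * P.mu) / (2 * (1 - P.mu)) * P.Cmu ^ 2 := by
  have h1 : 0 < 2 - 3 * P.mu := by linarith [hP.mu_lt]
  have h2 : 0 < 1 - P.mu := by linarith [hP.mu_lt]
  have h3 : 2 * (1 - P.mu) / (2 - 3 * P.mu) ≤ P.Cmu ^ 2 := by
    rw [← Real.sq_sqrt (show 0 ≤ 2 * (1 - P.mu) / (2 - 3 * P.mu) by positivity)]
    exact pow_le_pow_left₀ (Real.sqrt_nonneg _) (le_max_right _ _) 2
  calc (1 : ℝ) = (2 - 3 * P.mu) / (2 * (1 - P.mu)) * (2 * (1 - P.mu) / (2 - 3 * P.mu)) := by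
        field_simp
    _ ≤ _ := by gcongr

lemma integral_residual_sq_le {d n : ℕ} {P : Params} {ω : ℝ} {Fi : Fin n → E d → E d}
    {T : E d → Set (E d)} {Ω : Type*} [MeasurableSpace Ω] {μ : Measure Ω} [IsProbabilityMeasure μ]
    (hP : P.Admissible) (hn : P.LargeEnough ω n) (hF : IsAverageCocoercive P.L Fi)
    (hT : IsMaxCoHypomonotone P.ρ T) {xs : E d} (hxs : IsSolution Fi T xs) (x0 : E d)
    {U : ℕ → Ω → Draw n (P.batch ω n)} (hU : IsSarahSampling μ (P.prob ω n) U) (k : ℕ) :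
    (2 - 3 * P.mu) / (2 * (1 - P.mu)) * (P.t k - P.mu) ^ 2 *
      ∫ w, ‖residual Fi T P.lam (iter P Fi T x0 (fun i => U i w) k).x‖ ^ 2 ∂μ ≤
      P.Psi0 Fi T x0 xs ^ 2 := by
  have hb := hP.beta_pos
  have ht := hP.t_gt k
  have hmu := hP.mu_pos
  have h1 : ∀ s : State d, P.beta * ((2 - 3 * P.mu) / (2 * (1 - P.mu)) * (P.t k - P.mu) ^ 2) *
      ‖residual Fi T P.lam s.x‖ ^ 2 ≤ potential P Fi T xs (P.batch ω n) k s := by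
    intro s
    have h2 := le_lyapunov hmu hP.mu_lt hb hP.beta_mul_le
      (show 1 < P.t k - P.mu by linarith) (z := s.z) (residual_cocoercive_solution hP hF hT hxs s.x)
    have h3 : 0 ≤ (P.batch ω n : ℝ) * P.Lam * (P.t k * (P.t k - 1)) *
        ‖s.Ft - avg Fi s.x‖ ^ 2 := by
      have := hP.Lam_pos
      have h4 : 0 < P.t k * (P.t k - 1) := mul_pos (by linarith) (by linarith)
      positivity
    rw [potential]
    linarith
  have h2 := integral_mono
    ((integrable_iter hU P Fi T x0 k fun s => ‖residual Fi T P.lam s.x‖ ^ 2).const_mul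
      (P.beta * ((2 - 3 * P.mu) / (2 * (1 - P.mu)) * (P.t k - P.mu) ^ 2)))
    (integrable_iter hU P Fi T x0 k (potential P Fi T xs (P.batch ω n) k)) fun w => h1 _
  rw [integral_const_mul, mul_assoc] at h2
  exact le_of_mul_le_mul_left (h2.trans ((integral_potential_le hP hn hF hT hxs x0 hU k).trans
    (potential_zero_le hP Fi T x0 xs _))) hb

lemma integral_residual_sq_le_of_le {d n : ℕ} {P : Params} {ω : ℝ} {Fi : Fin n → E d → E d}
    {T : E d → Set (E d)} {Ω : Type*} [MeasurableSpace Ω] {μ : Measure Ω} [IsProbabilityMeasure μ]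
    (hP : P.Admissible) (hn : P.LargeEnough ω n) (hF : IsAverageCocoercive P.L Fi)
    (hT : IsMaxCoHypomonotone P.ρ T) {xs : E d} (hxs : IsSolution Fi T xs) (x0 : E d)
    {U : ℕ → Ω → Draw n (P.batch ω n)} (hU : IsSarahSampling μ (P.prob ω n) U) {k : ℕ} {ε : ℝ}
    (hε : 0 < ε) (hk : P.Cmu * P.Psi0 Fi T x0 xs / (P.mu * ε) ≤ k) :
    ∫ w, ‖residual Fi T P.lam (iter P Fi T x0 (fun i => U i w) k).x‖ ^ 2 ∂μ ≤ ε ^ 2 := by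
  have hmu := hP.mu_pos
  have h := integral_residual_sq_le hP hn hF hT hxs x0 hU k
  have hC := hP.one_le_Cmu_sq
  have hs : 0 < P.t k - P.mu := by linarith [hP.t_gt k]
  have hks : P.mu * k ≤ P.t k - P.mu := by
    have := hP.mu_mul_r_gt
    unfold Params.t
    linarith
  set q := (2 - 3 * P.mu) / (2 * (1 - P.mu)) with hq
  have hq0 : 0 < q := div_pos (by linarith [hP.mu_lt]) (by linarith [hP.mu_lt])
  set psi := P.Psi0 Fi T x0 xs with hpsi
  have hpsi0 : 0 ≤ P.Cmu * psi := mul_nonneg P.Cmu_nonneg (psi0_nonneg P Fi T x0 xs)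
  rw [div_le_iff₀ (by positivity)] at hk
  have h1 : P.Cmu * psi ≤ ε * (P.t k - P.mu) := by
    have := mul_le_mul_of_nonneg_left hks hε.le
    linarith
  have h2 : psi ^ 2 ≤ q * (P.t k - P.mu) ^ 2 * ε ^ 2 := by
    calc psi ^ 2 ≤ q * P.Cmu ^ 2 * psi ^ 2 := le_mul_of_one_le_left (sq_nonneg _) hC
      _ = q * (P.Cmu * psi) ^ 2 := by ring
      _ ≤ q * (ε * (P.t k - P.mu)) ^ 2 := by gcongr
      _ = _ := by ring
  exact le_of_mul_le_mul_left (h.trans h2) (by positivity)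

/-! ### The expected number of oracle calls -/

lemma dependsOn_oracleCalls {n b : ℕ} (K : ℕ) :
    DependsOn (fun u : ℕ → Draw n b => (oracleCalls u K : ℝ)) (Set.Iic K) := by
  intro u u' h
  simp only [oracleCalls, estimatorCost]
  congr 1
  refine Finset.sum_congr rfl fun k hk => ?_
  rw [h k (Set.mem_Iic.2 (Finset.mem_range.1 hk).le)]

lemma dependsOn_estimatorCost {n b : ℕ} (k : ℕ) :
    DependsOn (fun u : ℕ → Draw n b => (estimatorCost u k : ℝ)) (Set.Iic k) := by
  intro u u' h
  simp only [estimatorCost]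
  rw [h k (Set.mem_Iic.2 le_rfl)]

lemma integral_estimatorCost {n b : ℕ} {Ω : Type*} [MeasurableSpace Ω] {μ : Measure Ω}
    [IsProbabilityMeasure μ] {p : ℕ → ℝ} {U : ℕ → Ω → Draw n b} (hU : IsSarahSampling μ p U)
    (hn : 0 < n) (k : ℕ) :
    ∫ w, (estimatorCost (fun i => U i w) (k + 1) : ℝ) ∂μ =
      p (k + 1) * n + (1 - p (k + 1)) * (2 * b) := by
  have h1 := integral_eq_integral_sum hU.measurable hU.indep (k := k)
    (g := fun v _ => if v.1 = true then (n : ℝ) else 2 * b) (fun v u u' _ => rfl)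
  have h2 : ∀ w, (estimatorCost (fun i => U i w) (k + 1) : ℝ) =
      if (U (k + 1) w).1 = true then (n : ℝ) else 2 * b := fun w => by simp [estimatorCost]
  simp only [h2, h1, hU.measureReal_eq, sum_drawProb_mul, if_true, Bool.false_eq_true, if_false,
    ← Finset.sum_mul, sum_uniform hn, one_mul]
  simp

lemma inv_le_log_sub_log {x : ℝ} (hx : 1 < x) : 1 / x ≤ Real.log x - Real.log (x - 1) := by
  have h1 : 0 < x - 1 := by linarith
  have h2 := Real.one_sub_inv_le_log_of_pos (show 0 < x / (x - 1) by positivity)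
  rw [Real.log_div (by linarith) h1.ne'] at h2
  refine le_trans (le_of_eq ?_) h2
  field_simp
  ring

namespace Params

variable {P : Params} {ω : ℝ} {n : ℕ}

lemma Admissible.one_le_cp_mul (hP : P.Admissible) (hn : P.LargeEnough ω n) :
    1 ≤ P.cp * (n : ℝ) ^ ω := by
  have h1 := hP.mu_mul_r_gt
  have hmu := hP.mu_pos
  have hc := hP.cp_pos
  have h2 : 1 ≤ (P.mu * (P.r - 1) - 1) / (P.mu * (P.r - 3) - 1) := by
    rw [one_le_div (by linarith)]
    linarith
  have h3 : 1 / P.cp * 1 ≤ (n : ℝ) ^ ω :=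
    (mul_le_mul_of_nonneg_left (h2.trans (le_max_left _ _)) (by positivity)).trans hn.lower
  rw [mul_one, div_le_iff₀ hc] at h3
  linarith

/-- The terms `2μ / (t_k - 1)` of the switching probabilities are harmonic, and only those up to
`K₀` occur: their sum is at most twice the logarithm of `K₀ + r - 1 - 1/μ ≤ 2 c_p n^ω`. -/
lemma Admissible.sum_prob_le (hP : P.Admissible) (hn : P.LargeEnough ω n) (K : ℕ) :
    ∑ k ∈ Finset.range K, P.prob ω n (k + 1) ≤
      K * (2 / (P.cp * (n : ℝ) ^ ω)) + 2 * Real.log (2 * P.cp * (n : ℝ) ^ ω) := by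
  have hM := hP.one_le_cp_mul hn
  have hmu := hP.mu_pos
  obtain ⟨c, hc⟩ : ∃ c, c = P.r - 1 - 1 / P.mu := ⟨_, rfl⟩
  have hc2 : 2 < c := by linarith [hP.r_gt]
  suffices h : ∑ k ∈ Finset.range K, P.prob ω n (k + 1) ≤ K * (2 / (P.cp * (n : ℝ) ^ ω)) +
      2 * min (Real.log (K + c)) (Real.log (2 * P.cp * (n : ℝ) ^ ω)) from
    h.trans (by linarith [min_le_right (Real.log (K + c)) (Real.log (2 * P.cp * (n : ℝ) ^ ω))])
  induction K with
  | zero =>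
    have h1 : 0 ≤ Real.log c := Real.log_nonneg (by linarith)
    have h2 : 0 ≤ Real.log (2 * P.cp * (n : ℝ) ^ ω) := Real.log_nonneg (by linarith)
    simp [h1, h2]
  | succ K ih =>
    have hK : (0 : ℝ) ≤ K := Nat.cast_nonneg K
    rw [Finset.sum_range_succ, prob]
    push_cast
    split_ifs with h
    · rw [K0, Int.le_floor] at h
      push_cast at h
      have h1 : (K : ℝ) + 1 + c ≤ 2 * P.cp * (n : ℝ) ^ ω := by linarith
      have h2 : 2 * P.mu / (P.mu * (K + 1 + P.r - 1) - 1) = 2 * (1 / (K + 1 + c)) := by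
        have h3 : P.mu * (K + 1 + P.r - 1) - 1 = P.mu * (K + 1 + c) := by
          rw [hc]; field_simp; ring
        rw [h3]; field_simp
      have h3 := inv_le_log_sub_log (show 1 < (K : ℝ) + 1 + c by linarith)
      rw [show (K : ℝ) + 1 + c - 1 = K + c by ring] at h3
      have h4 : Real.log (K + 1 + c) ≤ Real.log (2 * P.cp * (n : ℝ) ^ ω) :=
        Real.log_le_log (by linarith) h1
      have h5 : 1 / (P.cp * (n : ℝ) ^ ω) ≤ 2 / (P.cp * (n : ℝ) ^ ω) := by gcongr; norm_num
      rw [min_eq_left h4, h2]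
      have h6 := min_le_left (Real.log (K + c)) (Real.log (2 * P.cp * (n : ℝ) ^ ω))
      linarith
    · have h1 : min (Real.log (K + c)) (Real.log (2 * P.cp * (n : ℝ) ^ ω)) ≤
          min (Real.log (K + 1 + c)) (Real.log (2 * P.cp * (n : ℝ) ^ ω)) :=
        min_le_min (Real.log_le_log (by linarith) (by linarith)) le_rfl
      linarith

end Params

lemma integral_oracleCalls_succ_le {n : ℕ} {P : Params} {ω : ℝ} {Ω : Type*} [MeasurableSpace Ω]
    {μ : Measure Ω} [IsProbabilityMeasure μ] (hP : P.Admissible) (hn : P.LargeEnough ω n)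
    {U : ℕ → Ω → Draw n (P.batch ω n)} (hU : IsSarahSampling μ (P.prob ω n) U) (m : ℕ) :
    ∫ w, (oracleCalls (fun i => U i w) (m + 1) : ℝ) ∂μ ≤
      n + 1 + 2 * n * Real.log (2 * P.cp * (n : ℝ) ^ ω) +
        m * (2 * P.cb * (n : ℝ) ^ ω + 2 * (n : ℝ) ^ (1 - ω) / P.cp + 1) := by
  have hint : ∀ k, Integrable (fun w => (estimatorCost (fun i => U i w) k : ℝ) + 1) μ := fun k =>
    (integrable_of_dependsOn hU.measurable (dependsOn_estimatorCost k)).add (integrable_const 1)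
  have h1 : ∀ k, ∫ w, ((estimatorCost (fun i => U i w) (k + 1) : ℝ) + 1) ∂μ ≤
      n * P.prob ω n (k + 1) + (2 * P.cb * (n : ℝ) ^ ω + 1) := by
    intro k
    rw [integral_add (integrable_of_dependsOn hU.measurable (dependsOn_estimatorCost _))
      (integrable_const 1), integral_estimatorCost hU hn.pos]
    have h2 := hP.batch_le hn
    have h3 := (hU.prob_mem hn.pos (k + 1)).1
    have h4 : 0 ≤ P.prob ω n (k + 1) * (P.batch ω n : ℝ) := by positivity
    simp only [integral_const, probReal_univ, smul_eq_mul, mul_one]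
    linarith
  have h0 : ∫ w, ((estimatorCost (fun i => U i w) 0 : ℝ) + 1) ∂μ = n + 1 := by
    simp [estimatorCost]
  have hN := Params.Admissible.rpow_pos hn
  have hn' : (0 : ℝ) < n := by exact_mod_cast hn.pos
  have hc := hP.cp_pos
  have h5 : (n : ℝ) * (2 / (P.cp * (n : ℝ) ^ ω)) = 2 * (n : ℝ) ^ (1 - ω) / P.cp := by
    rw [Real.rpow_sub hn', Real.rpow_one]; field_simp
  simp only [oracleCalls, Nat.cast_sum, Nat.cast_add, Nat.cast_one]
  rw [integral_finsetSum _ fun k _ => hint k, Finset.sum_range_succ', h0]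
  have h6 := Finset.sum_le_sum fun k (_ : k ∈ Finset.range m) => h1 k
  rw [Finset.sum_add_distrib, ← Finset.mul_sum, Finset.sum_const, Finset.card_range,
    nsmul_eq_mul] at h6
  have h7 := mul_le_mul_of_nonneg_left (hP.sum_prob_le hn m) hn'.le
  have h8 : (n : ℝ) * (m * (2 / (P.cp * (n : ℝ) ^ ω)) + 2 * Real.log (2 * P.cp * (n : ℝ) ^ ω)) =
      m * (2 * (n : ℝ) ^ (1 - ω) / P.cp) + 2 * n * Real.log (2 * P.cp * (n : ℝ) ^ ω) := by
    rw [← h5]; ring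
  linarith

lemma integral_oracleCalls_ceil_le {n : ℕ} {P : Params} {ω : ℝ} {Ω : Type*} [MeasurableSpace Ω]
    {μ : Measure Ω} [IsProbabilityMeasure μ] (hP : P.Admissible) (hn : P.LargeEnough ω n)
    {U : ℕ → Ω → Draw n (P.batch ω n)} (hU : IsSarahSampling μ (P.prob ω n) U) {psi ε : ℝ}
    (hpsi : 0 ≤ psi) (hε : 0 < ε) :
    ∫ w, (oracleCalls (fun i => U i w) ⌈P.Cmu * psi / (P.mu * ε)⌉₊ : ℝ) ∂μ ≤
      (P.complexityBound ω n psi ε : ℝ) := by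
  have hmu := hP.mu_pos
  have hX : 0 ≤ P.Cmu * psi / (P.mu * ε) :=
    div_nonneg (mul_nonneg P.Cmu_nonneg hpsi) (by positivity)
  have hn1 : (1 : ℝ) ≤ n := by exact_mod_cast hn.pos
  have hN := Params.Admissible.rpow_pos hn
  have hc := hP.cp_pos
  have hcb := hP.cb_pos
  have hD : 0 ≤ 2 * P.cb * (n : ℝ) ^ ω + 2 * (n : ℝ) ^ (1 - ω) / P.cp + 1 := by positivity
  have hlog : 0 ≤ Real.log (2 * P.cp * (n : ℝ) ^ ω) :=
    Real.log_nonneg (by linarith [hP.one_le_cp_mul hn])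
  have hfloor : (n : ℝ) + 2 * n * (2 + Real.log (2 * P.cp * (n : ℝ) ^ ω)) +
      P.Cmu * psi / (P.mu * ε) *
        (2 * P.cb * (n : ℝ) ^ ω + 2 * (n : ℝ) ^ (1 - ω) / P.cp + 1) - 1 <
      (P.complexityBound ω n psi ε : ℝ) := Int.sub_one_lt_floor _
  have hXD := mul_nonneg hX hD
  have hnlog : 0 ≤ 2 * n * Real.log (2 * P.cp * (n : ℝ) ^ ω) := by positivity
  -- Rounding the number of iterations up costs at most one iteration, which is the initial one
  -- and is already accounted for; the spare `4n` covers the rounding of the bound.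
  rcases h : ⌈P.Cmu * psi / (P.mu * ε)⌉₊ with _ | m
  · simp only [oracleCalls, Finset.range_zero, Finset.sum_empty, Nat.cast_zero, integral_zero]
    linarith
  · have hm : (m : ℝ) ≤ P.Cmu * psi / (P.mu * ε) :=
      (Nat.lt_ceil.1 (by omega : m < ⌈P.Cmu * psi / (P.mu * ε)⌉₊)).le
    have h1 := mul_le_mul_of_nonneg_right hm hD
    have h2 := integral_oracleCalls_succ_le hP hn hU m
    linarith

/-- The asymptotic form of the complexity bound for `ω = 1/2`. Since `n ≥ 2`, the term of order `n`
is absorbed into `n ln √n`. -/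
lemma exists_complexityBound_half_le {P : Params} (hP : P.Admissible) (psiMax : ℝ) :
    ∃ C : ℝ, 0 < C ∧ ∀ (n : ℕ) (psi ε : ℝ), 2 ≤ n → 0 ≤ psi → psi ≤ psiMax → 0 < ε →
      (P.complexityBound (1 / 2) n psi ε : ℝ) ≤
        C * ((n : ℝ) * Real.log (√(n : ℝ)) + √(n : ℝ) / ε) := by
  have hmu := hP.mu_pos
  have hc := hP.cp_pos
  have hcb := hP.cb_pos
  have hC := P.Cmu_nonneg
  have hl : 0 < Real.log (√2) := Real.log_pos (by
    rw [Real.lt_sqrt (by norm_num)]; norm_num)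
  set A := |5 + 2 * Real.log (2 * P.cp)| / Real.log (√2) with hA
  have hA0 : 0 ≤ A := by positivity
  set B := P.Cmu * max psiMax 0 / P.mu * (2 * P.cb + 2 / P.cp + 1) with hB
  have hB0 : 0 ≤ B := by positivity
  refine ⟨A + 2 + B, by positivity, fun n psi ε hn hpsi hpsi' hε => ?_⟩
  have hn2 : (2 : ℝ) ≤ n := by exact_mod_cast hn
  have hs1 : 1 ≤ √(n : ℝ) := Real.one_le_sqrt.2 (by linarith)
  have hlog : Real.log (√2) ≤ Real.log (√(n : ℝ)) :=
    Real.log_le_log (by positivity) (Real.sqrt_le_sqrt hn2)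
  refine (Int.floor_le _).trans ?_
  rw [show (1 : ℝ) - 1 / 2 = 1 / 2 by norm_num, ← Real.sqrt_eq_rpow,
    Real.log_mul (by positivity) (by positivity)]
  set s := √(n : ℝ)
  have h1 : 5 + 2 * Real.log (2 * P.cp) ≤ A * Real.log s := by
    calc 5 + 2 * Real.log (2 * P.cp) ≤ |5 + 2 * Real.log (2 * P.cp)| := le_abs_self _
      _ = A * Real.log (√2) := by rw [hA]; field_simp
      _ ≤ A * Real.log s := by gcongr
  have h2 := mul_le_mul_of_nonneg_left h1 (show (0 : ℝ) ≤ n by linarith)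
  have h3 : P.Cmu * psi / (P.mu * ε) * (2 * P.cb * s + 2 * s / P.cp + 1) ≤ B * (s / ε) := by
    calc P.Cmu * psi / (P.mu * ε) * (2 * P.cb * s + 2 * s / P.cp + 1)
        ≤ P.Cmu * max psiMax 0 / (P.mu * ε) * (2 * P.cb * s + 2 * s / P.cp + s) := by
          gcongr
          exact hpsi'.trans (le_max_left _ _)
      _ = B * (s / ε) := by rw [hB]; field_simp
  have h4 : 0 ≤ (n : ℝ) * Real.log s := mul_nonneg (by linarith) (hl.le.trans hlog)
  have h5 : 0 ≤ s / ε := by positivity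
  have h6 := mul_nonneg hA0 h5
  have h7 := mul_nonneg hB0 h4
  linarith

end VFOSA

end

theorem mainTheorem9 (P : VFOSA.Params) (hP : P.Admissible) (psiMax : ℝ) :
    ∃ C : ℝ, 0 < C ∧
      ∀ (d n : ℕ) (ω : ℝ) (_ : 0 ≤ ω) (_ : ω ≤ 1) (_ : P.LargeEnough ω n)
        (Fi : Fin n → VFOSA.E d → VFOSA.E d) (T : VFOSA.E d → Set (VFOSA.E d))
        (_ : VFOSA.IsAverageCocoercive P.L Fi) (_ : VFOSA.IsMaxCoHypomonotone P.ρ T)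
        (xs : VFOSA.E d) (_ : VFOSA.IsSolution Fi T xs)
        (x0 : VFOSA.E d) (_ : (T x0).Nonempty)
        (Ω : Type*) [MeasurableSpace Ω] (μ : MeasureTheory.Measure Ω)
        [MeasureTheory.IsProbabilityMeasure μ]
        (U : ℕ → Ω → VFOSA.Draw n (P.batch ω n))
        (_ : VFOSA.IsSarahSampling μ (P.prob ω n) U) (ε : ℝ) (_ : 0 < ε),
        (∃ K : ℕ,
          MeasureTheory.Integrable (fun w =>
            ‖VFOSA.residual Fi T P.lam
              (VFOSA.iter P Fi T x0 (fun k => U k w) K).x‖ ^ 2) μ ∧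
          ∫ w, ‖VFOSA.residual Fi T P.lam
              (VFOSA.iter P Fi T x0 (fun k => U k w) K).x‖ ^ 2 ∂μ ≤ ε ^ 2 ∧
          MeasureTheory.Integrable
            (fun w => (VFOSA.oracleCalls (fun k => U k w) K : ℝ)) μ ∧
          ∫ w, (VFOSA.oracleCalls (fun k => U k w) K : ℝ) ∂μ
            ≤ (P.complexityBound ω n (P.Psi0 Fi T x0 xs) ε : ℝ)) ∧
        (ω = 1 / 2 → 2 ≤ n → P.Psi0 Fi T x0 xs ≤ psiMax →
          (P.complexityBound ω n (P.Psi0 Fi T x0 xs) ε : ℝ)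
            ≤ C * ((n : ℝ) * Real.log (√(n : ℝ)) + √(n : ℝ) / ε)) := by
  obtain ⟨C, hC, hbound⟩ := VFOSA.exists_complexityBound_half_le hP psiMax
  refine ⟨C, hC, ?_⟩
  intro d n ω _ _ hn Fi T hF hT xs hxs x0 _ Ω _ μ _ U hU ε hε
  have hpsi := VFOSA.psi0_nonneg P Fi T x0 xs
  refine ⟨⟨⌈P.Cmu * P.Psi0 Fi T x0 xs / (P.mu * ε)⌉₊,
    VFOSA.integrable_iter hU P Fi T x0 _ fun s => ‖VFOSA.residual Fi T P.lam s.x‖ ^ 2,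
    VFOSA.integral_residual_sq_le_of_le hP hn hF hT hxs x0 hU hε (Nat.le_ceil _),
    VFOSA.integrable_of_dependsOn hU.measurable (VFOSA.dependsOn_oracleCalls _),
    VFOSA.integral_oracleCalls_ceil_le hP hn hU hpsi hε⟩, ?_⟩
  rintro rfl hn2 hmax
  exact hbound n _ ε hn2 hpsi hmax hε
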